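/- **Notation.** Let $\mathfrak C$ be the algebra of formal sums $X=\sum_{I}X_I\sigma^I$ with $X_I\in\mathbb C$, where $I$ runs over the finite subsets of a countably infinite set of indices, the generators satisfy $\sigma_i\sigma_j+\sigma_j\sigma_i=0$, and $\sigma^I$ is the ordered product of the $\sigma_i$, $i\in I$; it carries the Fréchet topology of convergence of every coefficient $X_I$. Let $\mathfrak R_{\rm ev}$ be the set of $X$ with $X_I=0$ for $|I|$ odd and with real body $X_{\rm B}:=X_\emptyset$, let $\mathfrak R_{\rm od}$ be the set of $X$ with $X_I=0$ for $|I|$ even, and let $\mathfrak R^{m|n}=\mathfrak R_{\rm ev}^m\times\mathfrak R_{\rm od}^n$ with the product topology. Its points are $X=(X_A)_{A=1}^{m+n}=(x,\theta)$; the body map is $\pi_{\rm B}(x,\theta)=(x_{1,{\rm B}},\dots,x_{m,{\rm B}})\in\mathbb R^m$, and $x_{\rm S}=x-x_{\rm B}$. Let $\mathfrak U\subset\mathfrak R^{m|n}$ be open and $f:\mathfrak U\to\mathfrak C$. The Gâteaux differential is $df(X)H=\lim_{t\to0,\,t\in\mathbb R}t^{-1}(f(X+tH)-f(X))$. * $f$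 is *$\infty$-times G-differentiable* if for every $r$ it is of class $C^r_G$: the iterated Gâteaux differentials $d^kf(X)\{H_1,\dots,H_k\}$, $k\le r$, exist and are jointly continuous on $\mathfrak U\times(\mathfrak R^{m|n})^k$. * $f\in\mathcal G^1_{SD}$ if there are continuous $F_A:\mathfrak U\to\mathfrak C$ with $df(X)H=\sum_{A=1}^{m+n}H_AF_A(X)$ for all $X\in\mathfrak U$, $H\in\mathfrak R^{m|n}$. For $r\ge2$, $f\in\mathcal G^r_{SD}$ if moreover $F_A\in\mathcal G^{r-1}_{SD}$ for every $A$. $\mathcal G^\infty_{SD}=\bigcap_{r\ge1}\mathcal G^r_{SD}$. * *Cauchy–Riemann equations*: regard $f$ as a function of the coordinates $X_{A,I}$ of $X_A=\sum_I X_{A,I}\sigma^I$, which are real for $I=\emptyset$ and complex for $I\ne\emptyset$. At every point of $\mathfrak U$ the partial derivatives $\partial f/\partial X_{A,I}$ exist (complex derivatives if $I\neq\emptyset$) and $$\frac{\partial f}{\partial X_{A,I}}=\sigma^I\frac{\partial f}{\partial X_{A,\emptyset}}\quad(1\le A\le m,\ |I|\text{ even}),$$ $$\sigma^K\frac{\partial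 f}{\partial X_{A,J}}+\sigma^J\frac{\partial f}{\partial X_{A,K}}=0\quad(m<A\le m+n,\ |J|,|K|\text{ odd}).$$ * For $u=\sum_J u_J\sigma^J$ with all $u_J\in C^\infty(\pi_{\rm B}(\mathfrak U):\mathbb C)$ (that is, $u\in C^\infty(\pi_{\rm B}(\mathfrak U):\mathfrak C)$), the *Grassmann continuation* is $\tilde u(x)=\sum_{\alpha\in\mathbb N^m}\frac1{\alpha!}\,\partial_q^\alpha u(q)\big|_{q=x_{\rm B}}\,x_{\rm S}^\alpha$. **Theorem 1.1.** Consider the conditions (a) $f\in\mathcal G^\infty_{SD}$ on $\mathfrak U$ ($f$ is superdifferentiable); (b) $f$ is $\infty$-times G-differentiable and $f\in\mathcal G^1_{SD}$ on $\mathfrak U$; (c) $f$ is $\infty$-times G-differentiable and $df(X)$ is $\mathfrak R_{\rm ev}$-linear for every $X\in\mathfrak U$; (d) $f$ is $\infty$-times G-differentiable and satisfies the Cauchy–Riemann equations on $\mathfrak U$; (e) $f$ is supersmooth: there are $f_a\in C^\infty(\pi_{\rm B}(\mathfrak U):\mathfrak C)$, $a\in\{0,1\}^n$, with $f(x,\theta)=\sum_{a}\theta^a\tilde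 f_a(x)$ for all $(x,\theta)\in\mathfrak U$, where $\theta^a=\theta_1^{a_1}\cdots\theta_n^{a_n}$. For every open $\mathfrak U$, (a)–(d) are equivalent, and (e) implies (a). If moreover every fibre $\{X\in\mathfrak U:\pi_{\rm B}(X)=q\}$, $q\in\mathbb R^m$, is connected or empty (as it is when $\mathfrak U$ is convex, or when $\mathfrak U=\pi_{\rm B}^{-1}(V)$ with $V\subset\mathbb R^m$ open), then (a)–(e) are all equivalent. -/

import Mathlib

open Filter Topology Set
open scoped ContDiff Nat

/-- The Fréchet–Grassmann algebra `ℭ` with countably many generators: formal sums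
`X = ∑_I X_I σ^I` with complex coefficients, `I` running over the finite sets of indices. -/
def FG : Type := Finset ℕ → ℂ

namespace FG

noncomputable instance : AddCommGroup FG := inferInstanceAs (AddCommGroup (Finset ℕ → ℂ))
noncomputable instance : Module ℂ FG := inferInstanceAs (Module ℂ (Finset ℕ → ℂ))

/-- The Fréchet topology of `ℭ`: convergence of every coefficient. -/
noncomputable instance : TopologicalSpace FG := inferInstanceAs (TopologicalSpace (Finset ℕ → ℂ))

@[ext] theorem ext {X Y : FG} (h : ∀ I, X I = Y I) : X = Y := funext h

@[simp] theorem add_apply (X Y : FG) (I : Finset ℕ) : (X + Y) I = X I + Y I := rfl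
@[simp] theorem zero_apply (I : Finset ℕ) : (0 : FG) I = 0 := rfl
@[simp] theorem neg_apply (X : FG) (I : Finset ℕ) : (-X) I = -X I := rfl
@[simp] theorem sub_apply (X Y : FG) (I : Finset ℕ) : (X - Y) I = X I - Y I := rfl
@[simp] theorem smul_apply (c : ℂ) (X : FG) (I : Finset ℕ) : (c • X) I = c * X I := rfl

/-- The number of inversions between `J` and `K`. -/
def inv (J K : Finset ℕ) : ℕ := ((J ×ˢ K).filter fun p => p.2 < p.1).card

/-- The sign in `σ^J σ^K = ± σ^(J ∪ K)` for disjoint `J`, `K`. -/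
def sgn (J K : Finset ℕ) : ℂ := (-1) ^ inv J K

/-- The product of `ℭ`: `(XY)_I = ∑_{I = J ⊔ K} ± X_J Y_K`. -/
noncomputable instance : Mul FG :=
  ⟨fun X Y I => ∑ J ∈ I.powerset, sgn J (I \ J) * (X J * Y (I \ J))⟩

/-- The monomial `c σ^I`. -/
noncomputable def mono (I : Finset ℕ) (c : ℂ) : FG := fun J => if J = I then c else 0

noncomputable instance : One FG := ⟨mono ∅ 1⟩

theorem mul_apply (X Y : FG) (I : Finset ℕ) :
    (X * Y) I = ∑ J ∈ I.powerset, sgn J (I \ J) * (X J * Y (I \ J)) := rfl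

theorem one_apply (I : Finset ℕ) : (1 : FG) I = if I = ∅ then 1 else 0 := rfl

theorem inv_union_left {J K : Finset ℕ} (h : Disjoint J K) (L : Finset ℕ) :
    inv (J ∪ K) L = inv J L + inv K L := by
  unfold inv
  rw [Finset.union_product, Finset.filter_union, Finset.card_union_of_disjoint]
  exact Finset.disjoint_filter_filter (Finset.disjoint_product.2 (Or.inl h))

theorem inv_union_right {K L : Finset ℕ} (h : Disjoint K L) (J : Finset ℕ) :
    inv J (K ∪ L) = inv J K + inv J L := by
  unfold inv
  rw [Finset.product_union, Finset.filter_union, Finset.card_union_of_disjoint]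
  exact Finset.disjoint_filter_filter (Finset.disjoint_product.2 (Or.inr h))

theorem sgn_assoc {J K L : Finset ℕ} (h1 : Disjoint J K) (h2 : Disjoint K L) :
    sgn (J ∪ K) L * sgn J K = sgn J (K ∪ L) * sgn K L := by
  unfold sgn
  rw [inv_union_left h1, inv_union_right h2, ← pow_add, ← pow_add]
  congr 1
  ring

theorem sgn_empty_left (K : Finset ℕ) : sgn ∅ K = 1 := by simp [sgn, inv]
theorem sgn_empty_right (K : Finset ℕ) : sgn K ∅ = 1 := by simp [sgn, inv]

theorem mul_assoc' (X Y Z : FG) : X * Y * Z = X * (Y * Z) := by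
  ext I
  simp only [mul_apply, Finset.mul_sum, Finset.sum_mul]
  rw [Finset.sum_sigma', Finset.sum_sigma']
  refine Finset.sum_bij' (fun p _ => ⟨p.2, p.1 \ p.2⟩) (fun p _ => ⟨p.1 ∪ p.2, p.1⟩)
    ?_ ?_ ?_ ?_ ?_
  · rintro ⟨A, B⟩ h
    simp only [Finset.mem_sigma, Finset.mem_powerset] at h ⊢
    exact ⟨h.2.trans h.1, Finset.sdiff_subset_sdiff h.1 le_rfl⟩
  · rintro ⟨A, B⟩ h
    simp only [Finset.mem_sigma, Finset.mem_powerset] at h ⊢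
    exact ⟨Finset.union_subset h.1 (h.2.trans Finset.sdiff_subset), Finset.subset_union_left⟩
  · rintro ⟨A, B⟩ h
    simp only [Finset.mem_sigma, Finset.mem_powerset] at h
    simp [Finset.union_sdiff_of_subset h.2]
  · rintro ⟨A, B⟩ h
    simp only [Finset.mem_sigma, Finset.mem_powerset] at h
    have : Disjoint A B := (Finset.disjoint_sdiff.mono_right h.2)
    simp [Finset.union_sdiff_cancel_left this]
  · rintro ⟨A, B⟩ h
    simp only [Finset.mem_sigma, Finset.mem_powerset] at h
    obtain ⟨hA, hB⟩ := h
    have e1 : (I \ B) \ (A \ B) = I \ A := by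
      ext x
      have := @hB x
      simp only [Finset.mem_sdiff]
      tauto
    have e2 : (A \ B) ∪ (I \ A) = I \ B := by
      ext x
      have := @hB x
      have := @hA x
      simp only [Finset.mem_union, Finset.mem_sdiff]
      tauto
    have key := sgn_assoc (J := B) (K := A \ B) (L := I \ A) Finset.disjoint_sdiff
      (Finset.disjoint_of_subset_left Finset.sdiff_subset Finset.disjoint_sdiff)
    rw [Finset.union_sdiff_of_subset hB, e2] at key
    simp only [e1]
    linear_combination (X B * Y (A \ B) * Z (I \ A)) * key

theorem one_mul' (X : FG) : 1 * X = X := by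
  ext I
  rw [mul_apply, Finset.sum_eq_single ∅]
  · simp [one_apply, sgn_empty_left]
  · intro J _ hJ
    simp [one_apply, hJ]
  · simp

theorem mul_one' (X : FG) : X * 1 = X := by
  ext I
  rw [mul_apply, Finset.sum_eq_single I]
  · simp [one_apply, sgn_empty_right]
  · intro J hJ hne
    have : I \ J ≠ ∅ := fun h =>
      hne (Finset.Subset.antisymm (Finset.mem_powerset.1 hJ) (Finset.sdiff_eq_empty_iff_subset.1 h))
    simp [one_apply, this]
  · simp

noncomputable instance : Ring FG :=
  { (inferInstance : AddCommGroup FG), (inferInstance : Mul FG), (inferInstance : One FG) with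
    left_distrib := fun X Y Z => by
      ext I
      simp only [mul_apply, add_apply, mul_add, Finset.sum_add_distrib]
    right_distrib := fun X Y Z => by
      ext I
      simp only [mul_apply, add_apply, add_mul, mul_add, Finset.sum_add_distrib]
    zero_mul := fun X => by ext I; simp [mul_apply]
    mul_zero := fun X => by ext I; simp [mul_apply]
    mul_assoc := mul_assoc'
    one_mul := one_mul'
    mul_one := mul_one' }

noncomputable instance : Algebra ℂ FG := Algebra.ofModule
  (fun c X Y => by
    ext I
    simp only [mul_apply, smul_apply, Finset.mul_sum]
    exact Finset.sum_congr rfl fun J _ => by ring)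
  (fun c X Y => by
    ext I
    simp only [mul_apply, smul_apply, Finset.mul_sum]
    exact Finset.sum_congr rfl fun J _ => by ring)

@[simp] theorem real_smul_apply (c : ℝ) (X : FG) (I : Finset ℕ) : (c • X) I = c * X I := rfl

theorem mul_empty (X Y : FG) : (X * Y) ∅ = X ∅ * Y ∅ := by
  simp [mul_apply, sgn_empty_left]

theorem card_add_card {I J : Finset ℕ} (h : J ∈ I.powerset) :
    J.card + (I \ J).card = I.card := by
  rw [add_comm]
  exact Finset.card_sdiff_add_card_eq_card (Finset.mem_powerset.1 h)

end FG

/-- The even real supernumbers `ℜ_ev`: only even degrees occur and the body is real. -/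
noncomputable def Rev : Subalgebra ℝ FG where
  carrier := {X | (∀ I, Odd I.card → X I = 0) ∧ (X ∅).im = 0}
  add_mem' := by
    rintro X Y ⟨h1, h2⟩ ⟨h3, h4⟩
    exact ⟨fun I hI => by simp [h1 I hI, h3 I hI], by simp [h2, h4]⟩
  mul_mem' := by
    rintro X Y ⟨h1, h2⟩ ⟨h3, h4⟩
    refine ⟨fun I hI => ?_, by simp [FG.mul_empty, h2, h4]⟩
    rw [FG.mul_apply]
    refine Finset.sum_eq_zero fun J hJ => ?_
    rw [← FG.card_add_card hJ] at hI
    rcases Nat.even_or_odd J.card with h | h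
    · rw [h3 _ ((Nat.odd_add'.1 hI).2 h)]
      simp
    · rw [h1 _ h]
      simp
  algebraMap_mem' := fun r => by
    rw [Algebra.algebraMap_eq_smul_one]
    refine ⟨fun I hI => ?_, by simp [FG.one_apply]⟩
    have : I ≠ ∅ := by
      rintro rfl
      simp at hI
    simp [FG.one_apply, this]

/-- The odd supernumbers `ℜ_od = ℭ_od`, a module over `ℜ_ev` by left multiplication. -/
noncomputable def Rod : Submodule Rev FG where
  carrier := {X | ∀ I, Even I.card → X I = 0}
  add_mem' := fun {X Y} h1 h2 I hI => by simp [h1 I hI, h2 I hI]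
  zero_mem' := fun I _ => rfl
  smul_mem' := by
    rintro ⟨X, hX, -⟩ Y hY I hI
    change (X * Y) I = 0
    rw [FG.mul_apply]
    refine Finset.sum_eq_zero fun J hJ => ?_
    rw [← FG.card_add_card hJ] at hI
    rcases Nat.even_or_odd J.card with h | h
    · rw [hY _ ((Nat.even_add.1 hI).1 h)]
      simp
    · rw [hX _ h]
      simp

/-- The superspace `ℜ^{m|n} = ℜ_ev^m × ℜ_od^n`, with the product topology. -/
abbrev SuperSpace (m n : ℕ) : Type := (Fin m → Rev) × (Fin n → Rod)

/-- The body map `π_B : ℜ^{m|n} → ℝ^m`. -/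
noncomputable def body {m n : ℕ} (X : SuperSpace m n) : Fin m → ℝ :=
  fun j => ((X.1 j : FG) ∅).re

/-! ### Gâteaux differentiability -/

section Gateaux

/-- `v` is the Gâteaux differential of `f` at `x` in the direction `y`:
`(f (x + t y) - f x) / t → v` as the real number `t ≠ 0` tends to `0`. -/
def HasGDiff {E Y : Type*} [AddCommGroup E] [Module ℝ E] [AddCommGroup Y] [Module ℝ Y]
    [TopologicalSpace Y] (f : E → Y) (x y : E) (v : Y) : Prop :=
  Tendsto (fun t : ℝ => t⁻¹ • (f (x + t • y) - f x)) (𝓝[≠] 0) (𝓝 v)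

/-- `f` is of class `C_G^r` on `U`: the iterated Gâteaux differentials
`d^k f (x) {y₁, …, y_k}`, `k ≤ r`, exist on `U` (`d^(k+1) f` being the Gâteaux differential of
`d^k f` in `x`, in the direction of the last argument) and are jointly continuous on `U × E^k`. -/
def IsCG {E Y : Type*} [AddCommGroup E] [Module ℝ E] [TopologicalSpace E]
    [AddCommGroup Y] [Module ℝ Y] [TopologicalSpace Y] (r : ℕ) (f : E → Y) (U : Set E) : Prop :=
  ∃ D : (k : ℕ) → E → (Fin k → E) → Y,
    (∀ x ∈ U, ∀ v, D 0 x v = f x) ∧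
    (∀ k < r, ∀ x ∈ U, ∀ (v : Fin k → E) (w : E),
      HasGDiff (fun z => D k z v) x w (D (k + 1) x (Fin.snoc (α := fun _ => E) v w))) ∧
    (∀ k ≤ r, ContinuousOn (fun p : E × (Fin k → E) => D k p.1 p.2) (U ×ˢ univ))

/-- `f` is `∞`-times Gâteaux differentiable on `U`, that is of class `C_G^∞ = ⋂_r C_G^r`. -/
def IsCGInfty {E Y : Type*} [AddCommGroup E] [Module ℝ E] [TopologicalSpace E]
    [AddCommGroup Y] [Module ℝ Y] [TopologicalSpace Y] (f : E → Y) (U : Set E) : Prop :=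
  ∀ r, IsCG r f U

end Gateaux

/-! ### Superdifferentiability -/

/-- The class `𝒢^r_SD` on `U` for `r ≥ 1` (for `r = 0`: the continuous functions). It asks for
continuous `F_A` with `d/dt f (X + t H) |_{t=0} = ∑_A H_A F_A (X)`, the `F_A` being
in `𝒢^(r-1)_SD` themselves. -/
def IsGSD {m n : ℕ} : ℕ → (SuperSpace m n → FG) → Set (SuperSpace m n) → Prop
  | 0, f, U => ContinuousOn f U
  | r + 1, f, U => ∃ (F : Fin m → SuperSpace m n → FG) (G : Fin n → SuperSpace m n → FG),
      (∀ j, ContinuousOn (F j) U) ∧ (∀ k, ContinuousOn (G k) U) ∧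
      (∀ X ∈ U, ∀ H : SuperSpace m n,
        HasGDiff f X H (∑ j, (H.1 j : FG) * F j X + ∑ k, (H.2 k : FG) * G k X)) ∧
      (∀ j, IsGSD r (F j) U) ∧ (∀ k, IsGSD r (G k) U)

/-- The class `𝒢^∞_SD` of superdifferentiable functions on `U`. -/
def IsGSDInfty {m n : ℕ} (f : SuperSpace m n → FG) (U : Set (SuperSpace m n)) : Prop :=
  ∀ r, 1 ≤ r → IsGSD r f U

/-- The Gâteaux differential of `f` exists on `U` and is `ℜ_ev`-linear in the direction. -/
def HasRevLinearGDiff {m n : ℕ} (f : SuperSpace m n → FG) (U : Set (SuperSpace m n)) : Prop :=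
  ∀ X ∈ U, ∃ L : SuperSpace m n →ₗ[Rev] FG, ∀ H, HasGDiff f X H (L H)

/-! ### The Cauchy–Riemann equations -/

/-- `c σ^I` as an element of `ℜ_ev`, for `I` non-empty of even cardinality. -/
noncomputable def evenMono (I : Finset ℕ) (hI : Even I.card) (h0 : I ≠ ∅) (c : ℂ) : Rev :=
  ⟨FG.mono I c, fun J hJ => if_neg (by rintro rfl; exact Nat.not_even_iff_odd.2 hJ hI), by
    rw [FG.mono, if_neg h0.symm, Complex.zero_im]⟩

/-- `c σ^I` as an element of `ℜ_od`, for `I` of odd cardinality. -/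
noncomputable def oddMono (I : Finset ℕ) (hI : Odd I.card) (c : ℂ) : Rod :=
  ⟨FG.mono I c, fun J hJ => if_neg (by rintro rfl; exact Nat.not_even_iff_odd.2 hI hJ)⟩

/-- The vector with entry `h` at the `j`-th even place and `0` elsewhere. -/
noncomputable def evenVec {m : ℕ} (n : ℕ) (j : Fin m) (h : Rev) : SuperSpace m n :=
  (Pi.single j h, 0)

/-- The vector with entry `h` at the `k`-th odd place and `0` elsewhere. -/
noncomputable def oddVec (m : ℕ) {n : ℕ} (k : Fin n) (h : Rod) : SuperSpace m n :=
  (0, Pi.single k h)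

/-- `v` is the complex derivative of `g : ℂ → ℭ` at `0`. -/
def HasComplexDerivAtZero (g : ℂ → FG) (v : FG) : Prop :=
  Tendsto (fun t : ℂ => t⁻¹ • (g t - g 0)) (𝓝[≠] 0) (𝓝 v)

/-- The Cauchy–Riemann equations for `f` on `U`, where `f` is viewed as a function of the
coordinates `X_{A,I}` (real for `I = ∅`, complex for `I ≠ ∅`). The values `P j I` and `Q k J` are
the partial derivatives of `f` in the coordinates `X_{j,I}` (`|I|` even) and
`X_{m+k,J}` (`|J|` odd). -/
def CauchyRiemann {m n : ℕ} (f : SuperSpace m n → FG) (U : Set (SuperSpace m n)) : Prop :=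
  ∀ X ∈ U, ∃ (P : Fin m → Finset ℕ → FG) (Q : Fin n → Finset ℕ → FG),
    (∀ j, HasGDiff f X (evenVec n j 1) (P j ∅)) ∧
    (∀ j I (hI : Even I.card) (h0 : I ≠ ∅),
      HasComplexDerivAtZero (fun t => f (X + evenVec n j (evenMono I hI h0 t))) (P j I)) ∧
    (∀ k J (hJ : Odd J.card),
      HasComplexDerivAtZero (fun t => f (X + oddVec m k (oddMono J hJ t))) (Q k J)) ∧
    (∀ j I, Even I.card → P j I = FG.mono I 1 * P j ∅) ∧
    (∀ k J K, Odd J.card → Odd K.card → FG.mono K 1 * Q k J + FG.mono J 1 * Q k K = 0)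

/-! ### Supersmooth functions -/

/-- `∂g/∂q_j`. -/
noncomputable def partialD {m : ℕ} (j : Fin m) (g : (Fin m → ℝ) → ℂ) : (Fin m → ℝ) → ℂ :=
  fun q => fderiv ℝ g q (Pi.single j 1)

/-- `∂^α g = ∂_1^{α_1} ⋯ ∂_m^{α_m} g`. -/
noncomputable def multiD {m : ℕ} (α : Fin m → ℕ) (g : (Fin m → ℝ) → ℂ) : (Fin m → ℝ) → ℂ :=
  (List.finRange m).foldr (fun j h => (partialD j)^[α j] h) g

/-- `∂^α u = ∑_J ∂^α u_J σ^J` for `u = ∑_J u_J σ^J` with values in `ℭ`. -/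
noncomputable def multiDFG {m : ℕ} (α : Fin m → ℕ) (u : (Fin m → ℝ) → FG) (q : Fin m → ℝ) : FG :=
  fun J => multiD α (fun p => u p J) q

/-- `u ∈ C^∞(V : ℭ)`: all coefficients are smooth on `V`. -/
def SmoothOnFG {m : ℕ} (u : (Fin m → ℝ) → FG) (V : Set (Fin m → ℝ)) : Prop :=
  ∀ J, ContDiffOn ℝ ∞ (fun p => u p J) V

/-- The soul `x_S` of `x ∈ ℜ_ev`. -/
noncomputable def soul (x : Rev) : FG := (x : FG) - FG.mono ∅ ((x : FG) ∅)

/-- `x_S^α = x_{1,S}^{α_1} ⋯ x_{m,S}^{α_m}`. -/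
noncomputable def soulPow {m : ℕ} (x : Fin m → Rev) (α : Fin m → ℕ) : FG :=
  ((List.finRange m).map fun j => soul (x j) ^ α j).prod

/-- `θ^a = θ_1^{a_1} ⋯ θ_n^{a_n}` for `a ∈ {0,1}^n`. -/
noncomputable def oddPow {n : ℕ} (θ : Fin n → Rod) (a : Fin n → Fin 2) : FG :=
  ((List.finRange n).map fun k => (θ k : FG) ^ (a k : ℕ)).prod

/-- The term `(1/α!) ∂^α u (x_B) x_S^α`. -/
noncomputable def contTerm {m : ℕ} (u : (Fin m → ℝ) → FG) (x : Fin m → Rev) (α : Fin m → ℕ) : FG :=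
  (∏ j, (α j)! : ℝ)⁻¹ • (multiDFG α u (fun j => ((x j : FG) ∅).re) * soulPow x α)

/-- The Grassmann continuation `ũ(x) = ∑_α (1/α!) ∂^α u (x_B) x_S^α`. -/
noncomputable def grassmannCont {m : ℕ} (u : (Fin m → ℝ) → FG) (x : Fin m → Rev) : FG :=
  ∑' α : Fin m → ℕ, contTerm u x α

/-- If the coefficients of `X`, `Y` vanish in degrees below `d`, `e`, those of `XY` vanish in
degrees below `d + e`. -/
theorem FG.mul_order {X Y : FG} {d e : ℕ} (hX : ∀ I, I.card < d → X I = 0)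
    (hY : ∀ I, I.card < e → Y I = 0) : ∀ I, I.card < d + e → (X * Y) I = 0 := by
  intro I hI
  rw [FG.mul_apply]
  refine Finset.sum_eq_zero fun J hJ => ?_
  have := FG.card_add_card hJ
  by_cases h : J.card < d
  · simp [hX J h]
  · simp [hY (I \ J) (by omega)]

theorem soulPow_order {m : ℕ} (x : Fin m → Rev) (α : Fin m → ℕ) (I : Finset ℕ)
    (hI : I.card < ∑ j, α j) : soulPow x α I = 0 := by
  have h1 : ∀ j I, I.card < 1 → soul (x j) I = 0 := by
    intro j I hI
    obtain rfl : I = ∅ := Finset.card_eq_zero.1 (by omega)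
    simp [soul, FG.mono]
  have h2 : ∀ j (k : ℕ) I, I.card < k → (soul (x j) ^ k) I = 0 := by
    intro j k
    induction k with
    | zero => intro I hI; omega
    | succ k ih => rw [pow_succ]; exact FG.mul_order ih (h1 j)
  have h3 : ∀ l : List (Fin m), ∀ I : Finset ℕ, I.card < (l.map α).sum →
      (l.map fun j => soul (x j) ^ α j).prod I = 0 := by
    intro l
    induction l with
    | nil => intro I hI; simp at hI
    | cons j l ih =>
      simp only [List.map_cons, List.prod_cons, List.sum_cons]
      exact FG.mul_order (h2 j _) ih
  refine h3 _ I ?_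
  rwa [← List.ofFn_eq_map, List.sum_ofFn]

/-- The series that defines the Grassmann continuation always converges. -/
theorem hasSum_grassmannCont {m : ℕ} (u : (Fin m → ℝ) → FG) (x : Fin m → Rev) :
    HasSum (contTerm u x) (grassmannCont u x) := by
  have hT : T2Space FG := inferInstanceAs (T2Space (Finset ℕ → ℂ))
  refine Summable.hasSum ?_
  have : ∀ I : Finset ℕ, Summable fun α => contTerm u x α I := by
    intro I
    refine summable_of_hasFiniteSupport ((Set.finite_Iic (fun _ : Fin m => I.card)).subset ?_)
    intro α hα j
    by_contra hj
    refine hα ?_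
    have h : I.card < ∑ j, α j :=
      lt_of_lt_of_le (not_le.1 hj) (Finset.single_le_sum (f := α) (fun _ _ => Nat.zero_le _)
        (Finset.mem_univ j))
    have := FG.mul_order (X := multiDFG α u (fun j => ((x j : FG) ∅).re)) (d := 0)
      (fun I hI => absurd hI (by omega)) (soulPow_order x α) I (by omega)
    simp [contTerm, this]
  exact Pi.summable.2 this

/-- `f` is supersmooth on `U`: `f(x,θ) = ∑_a θ^a ũ_a(x)` on `U` with `u_a ∈ C^∞(π_B(U) : ℭ)`. -/
def IsSupersmooth {m n : ℕ} (f : SuperSpace m n → FG) (U : Set (SuperSpace m n)) : Prop :=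
  ∃ u : (Fin n → Fin 2) → (Fin m → ℝ) → FG,
    (∀ a, SmoothOnFG (u a) (body '' U)) ∧
    ∀ X ∈ U, f X = ∑ a, oddPow X.2 a * grassmannCont (u a) X.1

/-! ### Topology and algebra of the Fréchet–Grassmann algebra -/

section

-- The algebraic heart is that infinitely many generators allow division by odd elements. For every
-- finite `I` there is a generator outside `I`, so an element of `ℭ` is determined by its products
-- with the `σ_i` (`FG.eq_of_gen_mul_eq`). A family `L_i` with `σ_k L_i + σ_i L_k = 0` even has a
-- common left quotient (`FG.gen_mul_quot`). Hence every `ℜ_ev`-linear map on the superspace has the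
-- form `H ↦ ∑_A H_A F_A` (`linearMap_eq_superLin`), with coefficients read off from its values on
-- countably many vectors. This turns pointwise linearity of `df` into continuous coefficients.
--
-- The passage from one superderivative to all of them rests on the symmetry of the second Gâteaux
-- differential (`IsCG.hasGDiff_symm`): exchanging the two directions transfers the `ℜ_ev`-linearity
-- of `df` to the differentials of the coefficients `F_A` (`HasSD.hasRevLinearGDiff`), and the
-- argument iterates. The Cauchy–Riemann equations prescribe `df` on monomials; additivity and
-- continuity of `df` in the direction extend this to all directions.
--
-- The Grassmann continuation is a series with only finitely many non-zero terms in each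
-- coefficient, because souls have no degree-zero part. It may be differentiated term by term, and
-- its even derivatives are the continuations of the partial derivatives (`hasGDiff_grassmannCont`).
-- Hence supersmooth functions are superdifferentiable.
--
-- For the converse, odd derivatives anticommute, so `f` splits as `f0 + θ_k f1` with both parts
-- constant in the `k`-th odd direction (`exists_odd_split`); this reduces to functions with no odd
-- derivatives. For these the coefficients are treated by degree: if all coefficients of degree
-- below `d` vanish, those of degree `d` have zero differential in every direction without body.
-- They are therefore locally constant on the fibres of the body map, and constant when the fibres
-- are connected. Subtracting the continuation of the resulting smooth function of the body raises
-- `d` by one (`IsEvenOrder.exists_sub`), and the pieces of different degrees assemble into a single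
-- `u`.

local instance : IsTopologicalAddGroup FG := inferInstanceAs (IsTopologicalAddGroup (Finset ℕ → ℂ))
local instance : ContinuousSMul ℂ FG := inferInstanceAs (ContinuousSMul ℂ (Finset ℕ → ℂ))
local instance : ContinuousSMul ℝ FG := IsScalarTower.continuousSMul ℂ
local instance : T2Space FG := inferInstanceAs (T2Space (Finset ℕ → ℂ))

namespace FG

theorem continuous_apply (I : Finset ℕ) : Continuous fun X : FG => X I :=
  _root_.continuous_apply (A := fun _ : Finset ℕ => ℂ) I

theorem continuous_iff {α : Type*} [TopologicalSpace α] {f : α → FG} :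
    Continuous f ↔ ∀ I, Continuous fun a => f a I :=
  continuous_pi_iff (A := fun _ : Finset ℕ => ℂ)

theorem continuousOn_iff {α : Type*} [TopologicalSpace α] {f : α → FG} {s : Set α} :
    ContinuousOn f s ↔ ∀ I, ContinuousOn (fun a => f a I) s :=
  continuousOn_pi (X := fun _ : Finset ℕ => ℂ)

theorem tendsto_iff {α : Type*} {f : α → FG} {l : Filter α} {X : FG} :
    Tendsto f l (𝓝 X) ↔ ∀ I, Tendsto (fun a => f a I) l (𝓝 (X I)) :=
  tendsto_pi_nhds (A := fun _ : Finset ℕ => ℂ)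

theorem sum_apply {ι : Type*} (s : Finset ι) (f : ι → FG) (I : Finset ℕ) :
    (∑ i ∈ s, f i) I = ∑ i ∈ s, f i I :=
  Finset.sum_apply (M := fun _ : Finset ℕ => ℂ) I s f

/-! ### Signs, parity and division by generators -/

theorem inv_add_inv {J K : Finset ℕ} (h : Disjoint J K) :
    inv J K + inv K J = J.card * K.card := by
  have h1 : inv K J = ((J ×ˢ K).filter fun p => ¬ p.2 < p.1).card := by
    unfold inv
    refine Finset.card_bij' (fun p _ => p.swap) (fun p _ => p.swap) ?_ ?_ ?_ ?_
    · rintro ⟨a, b⟩ hp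
      simp only [Finset.mem_filter, Finset.mem_product, Prod.swap] at hp ⊢
      exact ⟨⟨hp.1.2, hp.1.1⟩, by omega⟩
    · rintro ⟨a, b⟩ hp
      simp only [Finset.mem_filter, Finset.mem_product, Prod.swap] at hp ⊢
      have : a ≠ b := fun hab => Finset.disjoint_left.1 h hp.1.1 (hab ▸ hp.1.2)
      exact ⟨⟨hp.1.2, hp.1.1⟩, by omega⟩
    · simp
    · simp
  rw [h1, inv, Finset.card_filter_add_card_filter_not, Finset.card_product]

theorem sgn_mul_self (J K : Finset ℕ) : sgn J K * sgn J K = 1 := by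
  rw [sgn, ← mul_pow]
  simp

theorem sgn_ne_zero (J K : Finset ℕ) : sgn J K ≠ 0 := fun h => by
  have := sgn_mul_self J K
  simp [h] at this

theorem sgn_swap {J K : Finset ℕ} (h : Disjoint J K) :
    sgn J K = (-1) ^ (J.card * K.card) * sgn K J := by
  have h1 : sgn J K * sgn K J = (-1) ^ (J.card * K.card) := by
    rw [← inv_add_inv h, pow_add]
    rfl
  rw [← h1, mul_assoc, sgn_mul_self, mul_one]

/-- Passing from `J` to its complement in `I` matches the terms of the two products, which then
differ only by signs. Both commutation rules follow by comparing parities. -/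
theorem mul_apply_swap (X Y : FG) (I : Finset ℕ) :
    (Y * X) I = ∑ J ∈ I.powerset,
      (-1) ^ (J.card * (I \ J).card) * (sgn J (I \ J) * (X J * Y (I \ J))) := by
  rw [mul_apply]
  refine Finset.sum_bij' (fun J _ => I \ J) (fun J _ => I \ J) ?_ ?_ ?_ ?_ ?_
  · intro J _
    simp
  · intro J _
    simp
  · intro J hJ
    simpa using Finset.mem_powerset.1 hJ
  · intro J hJ
    simpa using Finset.mem_powerset.1 hJ
  · intro J hJ
    have e : I \ (I \ J) = J := by simpa using Finset.mem_powerset.1 hJ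
    rw [e, sgn_swap Finset.disjoint_sdiff, mul_comm J.card]
    ring

/-- Only coefficients of even degree occur. -/
def IsEven (X : FG) : Prop := ∀ I, Odd I.card → X I = 0

/-- Only coefficients of odd degree occur. -/
def IsOdd (X : FG) : Prop := ∀ I, Even I.card → X I = 0

theorem IsEven.commute {X : FG} (hX : IsEven X) (Y : FG) : X * Y = Y * X := by
  ext I
  rw [mul_apply_swap X Y, mul_apply X Y]
  refine Finset.sum_congr rfl fun J _ => ?_
  rcases Nat.even_or_odd J.card with h | h
  · rw [(h.mul_right _).neg_one_pow, one_mul]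
  · simp [hX J h]

theorem IsOdd.anticommute {X Y : FG} (hX : IsOdd X) (hY : IsOdd Y) : X * Y = -(Y * X) := by
  ext I
  rw [neg_apply, mul_apply_swap X Y, mul_apply X Y, ← Finset.sum_neg_distrib]
  refine Finset.sum_congr rfl fun J _ => ?_
  rcases Nat.even_or_odd J.card with h | h
  · rw [hX J h]
    ring
  rcases Nat.even_or_odd (I \ J).card with h' | h'
  · rw [hY _ h']
    ring
  · rw [(h.mul h').neg_one_pow]
    ring

theorem eq_zero_of_eq_neg {X : FG} (h : X = -X) : X = 0 := by
  ext I
  have := congrFun h I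
  rw [neg_apply] at this
  exact self_eq_neg.1 this

theorem IsOdd.mul_self {X : FG} (hX : IsOdd X) : X * X = 0 :=
  eq_zero_of_eq_neg (hX.anticommute hX)

theorem IsOdd.mul_left_comm {X Y : FG} (hX : IsOdd X) (hY : IsOdd Y) (Z : FG) :
    X * (Y * Z) = -(Y * (X * Z)) := by
  rw [← mul_assoc, hX.anticommute hY, neg_mul, mul_assoc]

theorem IsEven.mul_left_comm {X : FG} (hX : IsEven X) (Y Z : FG) :
    X * (Y * Z) = Y * (X * Z) := by
  rw [← mul_assoc, hX.commute, mul_assoc]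

theorem mono_apply (I J : Finset ℕ) (c : ℂ) : mono I c J = if J = I then c else 0 := rfl

theorem mono_mul_apply (J : Finset ℕ) (c : ℂ) (X : FG) (I : Finset ℕ) :
    (mono J c * X) I = if J ⊆ I then sgn J (I \ J) * (c * X (I \ J)) else 0 := by
  rw [mul_apply]
  split_ifs with h
  · rw [Finset.sum_eq_single J]
    · simp [mono_apply]
    · intro K _ hK
      simp [mono_apply, hK]
    · intro hJ
      exact absurd (Finset.mem_powerset.2 h) hJ
  · refine Finset.sum_eq_zero fun K hK => ?_
    have : K ≠ J := by
      rintro rfl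
      exact h (Finset.mem_powerset.1 hK)
    simp [mono_apply, this]

theorem mono_smul (J : Finset ℕ) (a c : ℂ) : mono J (a * c) = a • mono J c := by
  ext I
  simp [mono_apply]

/-- The generator `σ_i`. -/
noncomputable def gen (i : ℕ) : FG := mono {i} 1

theorem gen_isOdd (i : ℕ) : IsOdd (gen i) := by
  intro I hI
  rw [gen, mono_apply, if_neg]
  rintro rfl
  simp at hI

theorem gen_mul_apply_insert {i : ℕ} {I : Finset ℕ} (hi : i ∉ I) (X : FG) :
    (gen i * X) (insert i I) = sgn {i} I * X I := by
  rw [gen, mono_mul_apply, if_pos (by simp)]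
  have : insert i I \ {i} = I := by
    rw [Finset.sdiff_singleton_eq_erase, Finset.erase_insert hi]
  rw [this, one_mul]

theorem gen_mul_apply_of_notMem {i : ℕ} {I : Finset ℕ} (hi : i ∉ I) (X : FG) :
    (gen i * X) I = 0 := by
  rw [gen, mono_mul_apply, if_neg (by simpa using hi)]

/-- An index that does not occur in `I`. -/
def fresh (I : Finset ℕ) : ℕ := I.sup id + 1

theorem fresh_notMem (I : Finset ℕ) : fresh I ∉ I := fun h => by
  have : fresh I ≤ I.sup id := Finset.le_sup (f := id) h
  exact absurd this (Nat.not_succ_le_self _)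

/-- Multiplication by `σ_i` kills exactly the monomials containing `i`. Each coefficient `I`
therefore survives multiplication by a generator outside `I`, which exists because there are
infinitely many. -/
theorem eq_of_gen_mul_eq {X Y : FG} (h : ∀ i, gen i * X = gen i * Y) : X = Y := by
  ext I
  have := congrFun (h (fresh I)) (insert (fresh I) I)
  rw [gen_mul_apply_insert (fresh_notMem I), gen_mul_apply_insert (fresh_notMem I)] at this
  exact mul_left_cancel₀ (sgn_ne_zero _ _) this

/-- The common left quotient `G` of a family `L` with `L i = σ_i G`. -/
noncomputable def quot (L : ℕ → FG) : FG :=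
  fun I => sgn {fresh I} I * L (fresh I) (insert (fresh I) I)

theorem quot_apply (L : ℕ → FG) (I : Finset ℕ) :
    quot L I = sgn {fresh I} I * L (fresh I) (insert (fresh I) I) := rfl

theorem gen_mul_quot {L : ℕ → FG} (h : ∀ i k, gen k * L i + gen i * L k = 0) (i : ℕ) :
    gen i * quot L = L i := by
  -- The hypothesis with `k = i` reads `2 σ_i L_i = 0`, so every monomial of `L_i` contains `i`.
  have hzero : ∀ i K, i ∉ K → L i K = 0 := by
    intro i K hK
    have := congrFun (h i i) (insert i K)
    rw [add_apply, gen_mul_apply_insert hK, zero_apply, ← two_mul] at this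
    simpa [sgn_ne_zero] using this
  ext K
  by_cases hi : i ∈ K
  · obtain ⟨I, hI, rfl⟩ : ∃ I, i ∉ I ∧ insert i I = K :=
      ⟨K.erase i, Finset.notMem_erase i K, Finset.insert_erase hi⟩
    rw [gen_mul_apply_insert hI, quot_apply]
    generalize hp : fresh I = p
    have hpI : p ∉ I := hp ▸ fresh_notMem I
    rcases eq_or_ne i p with rfl | hip
    · rw [← mul_assoc, sgn_mul_self, one_mul]
    -- At the coefficient `I ∪ {i, p}` the relation between `L_i` and `L_p` says that the quotient
    -- read off through `i` agrees with the one read off through `p`.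
    · have key := congrFun (h i p) (insert i (insert p I))
      have e1 : i ∉ insert p I := by simp [hip, hI]
      have e2 : p ∉ insert i I := by simp [hip.symm, hpI]
      rw [add_apply, gen_mul_apply_insert e1, Finset.insert_comm, gen_mul_apply_insert e2,
        zero_apply] at key
      have s1 : sgn {i} (insert p I) = sgn {i} {p} * sgn {i} I := by
        rw [Finset.insert_eq, sgn, inv_union_right (by simpa using hpI), pow_add]
        rfl
      have s2 : sgn {p} (insert i I) = sgn {p} {i} * sgn {p} I := by
        rw [Finset.insert_eq, sgn, inv_union_right (by simpa using hI), pow_add]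
        rfl
      have s3 : sgn {i} {p} = -sgn {p} {i} := by
        rw [sgn_swap (by simpa using hip)]
        simp
      rw [s1, s2, s3] at key
      have key2 : sgn {p} I * L i (insert i I) = sgn {i} I * L p (insert p I) := by
        refine mul_left_cancel₀ (sgn_ne_zero {p} {i}) ?_
        linear_combination key
      have e := sgn_mul_self {p} I
      linear_combination (-sgn {p} I) * key2 + L i (insert i I) * e
  · rw [gen_mul_apply_of_notMem hi, hzero i K hi]

theorem mul_of_mul_order {X Y : FG} {d : ℕ} (hY : ∀ I, I.card < d → Y I = 0) :
    ∀ I, I.card < d → (X * Y) I = 0 := fun I hI =>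
  mul_order (d := 0) (X := X) (fun _ h => absurd h (Nat.not_lt_zero _)) hY I (by omega)

end FG

local instance : ContinuousMul FG where
  continuous_mul := by
    refine FG.continuous_iff.2 fun I => ?_
    simp only [FG.mul_apply]
    refine continuous_finsetSum _ fun J _ => continuous_const.mul ?_
    exact ((FG.continuous_apply J).comp continuous_fst).mul
      ((FG.continuous_apply _).comp continuous_snd)

local instance : IsTopologicalSemiring FG where

theorem isEven_coe (x : Rev) : FG.IsEven (x : FG) := x.2.1

theorem isOdd_coe (θ : Rod) : FG.IsOdd (θ : FG) := θ.2

theorem Rev.smul_eq (x : Rev) (X : FG) : x • X = (x : FG) * X := rfl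

theorem Rod.coe_smul (x : Rev) (θ : Rod) : ((x • θ : Rod) : FG) = (x : FG) * θ := rfl

theorem Rev.coe_real_smul (c : ℝ) (x : Rev) : ((c • x : Rev) : FG) = c • (x : FG) := rfl

/-- `σ_i` as an odd supernumber. -/
noncomputable def oddGen (i : ℕ) : Rod := ⟨FG.gen i, FG.gen_isOdd i⟩

theorem FG.eq_of_rod_mul_eq {X Y : FG} (h : ∀ θ : Rod, (θ : FG) * X = θ * Y) : X = Y :=
  FG.eq_of_gen_mul_eq fun i => h (oddGen i)

/-- The product of two odd supernumbers, an even one. -/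
noncomputable def Rod.prod (θ η : Rod) : Rev :=
  ⟨(θ : FG) * η, fun I hI => by
    rw [FG.mul_apply]
    refine Finset.sum_eq_zero fun J hJ => ?_
    rw [← FG.card_add_card hJ] at hI
    rcases Nat.even_or_odd J.card with h | h
    · rw [θ.2 _ h]
      simp
    · rw [η.2 _ ((Nat.odd_add.1 hI).1 h)]
      simp, by
    have := θ.2 ∅ (by simp)
    rw [FG.mul_empty, this]
    simp⟩

/-- Every `ℜ_ev`-linear map `ℜ_od → ℭ` is the multiplication by an element of `ℭ`. -/
theorem Rod.linearMap_eq_mul (L : Rod →ₗ[Rev] FG) (θ : Rod) :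
    L θ = (θ : FG) * FG.quot fun i => L (oddGen i) := by
  have h3 : ∀ a b c : Rod, (a : FG) * (b * L c) = ((a : FG) * b) * L c := fun a b c =>
    (mul_assoc _ _ _).symm
  -- Only even factors pass through `L`. A single odd factor does not, but a product of two does;
  -- this is why an auxiliary odd `a` is multiplied in throughout.
  have hp : ∀ a b c : Rod, (a : FG) * (b * L c) = L (Rod.prod a b • c) := fun a b c => by
    rw [h3, L.map_smul]
    rfl
  have hs : ∀ a b c : Rod, Rod.prod a b • c = -(Rod.prod a c • b) := fun a b c => by
    apply Subtype.ext
    change (a : FG) * b * c = -((a : FG) * c * b)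
    rw [mul_assoc, mul_assoc (a : FG), (isOdd_coe b).anticommute (isOdd_coe c), mul_neg]
  have hL : ∀ i k, FG.gen k * L (oddGen i) + FG.gen i * L (oddGen k) = 0 := by
    intro i k
    refine FG.eq_of_rod_mul_eq fun a => ?_
    change (a : FG) * ((oddGen k : FG) * L (oddGen i) + (oddGen i : FG) * L (oddGen k)) = _
    rw [mul_add, hp, hp, hs, L.map_neg, mul_zero, neg_add_cancel]
  -- With `G` the quotient, the chain is `σ_k a L(θ) = -L(σ_k θ a) = a θ L(σ_k) = a θ σ_k G`, and
  -- the even element `a θ` commutes with `σ_k`.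
  refine FG.eq_of_rod_mul_eq fun a => FG.eq_of_gen_mul_eq fun k => ?_
  have h1 : FG.gen k * ((a : FG) * L θ) = -L (Rod.prod (oddGen k) θ • a) := by
    change ((oddGen k : Rod) : FG) * _ = _
    rw [hp, hs, L.map_neg]
  have h2 : L (Rod.prod (oddGen k) θ • a) = -((a : FG) * θ * L (oddGen k)) := by
    have : Rod.prod (oddGen k) θ • a = -(Rod.prod a θ • oddGen k) := by
      apply Subtype.ext
      change ((oddGen k : Rod) : FG) * θ * a = -((a : FG) * θ * oddGen k)
      rw [mul_assoc, (isOdd_coe θ).anticommute (isOdd_coe a), mul_neg]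
      exact congrArg _ ((isEven_coe (Rod.prod a θ)).commute _).symm
    rw [this, L.map_neg, L.map_smul]
    rfl
  have h4 := FG.gen_mul_quot hL k
  rw [h1, h2, neg_neg, ← h4]
  change _ = FG.gen k * ((a : FG) * (θ * _))
  rw [← mul_assoc (a : FG) (θ : FG), ← mul_assoc, ← mul_assoc (FG.gen k)]
  exact congrArg (· * _) ((isEven_coe (Rod.prod a θ)).commute _)

/-! ### Calculus of Gâteaux differentials -/

section

variable {E : Type*} [AddCommGroup E] [Module ℝ E]

theorem hasGDiff_iff_apply {f : E → FG} {x y : E} {v : FG} :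
    HasGDiff f x y v ↔ ∀ I, HasGDiff (fun z => f z I) x y (v I) := by
  unfold HasGDiff
  rw [FG.tendsto_iff]
  simp only [FG.real_smul_apply, FG.sub_apply, Complex.real_smul]

theorem hasGDiff_iff_hasDerivAt {f : E → ℂ} {x y : E} {v : ℂ} :
    HasGDiff f x y v ↔ HasDerivAt (fun t : ℝ => f (x + t • y)) v 0 := by
  rw [hasDerivAt_iff_tendsto_slope_zero]
  simp [HasGDiff]

theorem HasGDiff.hasDerivAt {f : E → ℂ} {x y : E} {v : ℂ} {s : ℝ}
    (h : HasGDiff f (x + s • y) y v) : HasDerivAt (fun t : ℝ => f (x + t • y)) v s := by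
  rw [hasDerivAt_iff_tendsto_slope_zero]
  simpa [HasGDiff, add_smul, add_assoc] using h

theorem HasGDiff.unique {Y : Type*} [AddCommGroup Y] [Module ℝ Y] [TopologicalSpace Y] [T2Space Y]
    {f : E → Y} {x y : E} {v w : Y} (hv : HasGDiff f x y v) (hw : HasGDiff f x y w) : v = w :=
  tendsto_nhds_unique hv hw

theorem HasGDiff.smul_dir {Y : Type*} [AddCommGroup Y] [Module ℝ Y] [TopologicalSpace Y]
    [ContinuousSMul ℝ Y]
    {f : E → Y} {x y : E} {v : Y} (h : HasGDiff f x y v) (c : ℝ) :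
    HasGDiff f x (c • y) (c • v) := by
  rcases eq_or_ne c 0 with rfl | hc
  · simpa [HasGDiff] using tendsto_const_nhds
  · have h1 : Tendsto (fun t : ℝ => t * c) (𝓝[≠] 0) (𝓝[≠] 0) := by
      refine tendsto_nhdsWithin_iff.2 ⟨?_, ?_⟩
      · have : Tendsto (fun t : ℝ => t * c) (𝓝 0) (𝓝 (0 * c)) := tendsto_id.mul_const c
        rw [zero_mul] at this
        exact this.mono_left nhdsWithin_le_nhds
      · filter_upwards [self_mem_nhdsWithin] with t ht
        simpa [hc] using ht
    refine ((h.comp h1).const_smul c).congr fun t => ?_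
    simp only [Function.comp, smul_smul, mul_inv]
    rw [mul_comm t⁻¹, ← mul_assoc, mul_inv_cancel₀ hc, one_mul]

theorem hasGDiff_zero_dir {Y : Type*} [AddCommGroup Y] [Module ℝ Y] [TopologicalSpace Y]
    (f : E → Y) (x : E) : HasGDiff f x 0 0 := by
  simpa [HasGDiff] using tendsto_const_nhds

theorem HasGDiff.add {f g : E → FG} {x y : E} {v w : FG} (hf : HasGDiff f x y v)
    (hg : HasGDiff g x y w) : HasGDiff (fun z => f z + g z) x y (v + w) := by
  rw [hasGDiff_iff_apply] at *
  exact fun I => hasGDiff_iff_hasDerivAt.2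
    ((hasGDiff_iff_hasDerivAt.1 (hf I)).add (hasGDiff_iff_hasDerivAt.1 (hg I)))

theorem HasGDiff.sub {f g : E → FG} {x y : E} {v w : FG} (hf : HasGDiff f x y v)
    (hg : HasGDiff g x y w) : HasGDiff (fun z => f z - g z) x y (v - w) := by
  rw [hasGDiff_iff_apply] at *
  exact fun I => hasGDiff_iff_hasDerivAt.2
    ((hasGDiff_iff_hasDerivAt.1 (hf I)).sub (hasGDiff_iff_hasDerivAt.1 (hg I)))

theorem hasGDiff_const (c : FG) (x y : E) : HasGDiff (fun _ => c) x y 0 := by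
  simp [HasGDiff]

theorem hasDerivAt_apply_mul {f g : E → FG} {x y : E} {v w : FG} (hf : HasGDiff f x y v)
    (hg : HasGDiff g x y w) (I : Finset ℕ) :
    HasDerivAt (fun t : ℝ => (f (x + t • y) * g (x + t • y)) I) ((v * g x + f x * w) I) 0 := by
  rw [hasGDiff_iff_apply] at hf hg
  simp only [FG.mul_apply, FG.add_apply, ← Finset.sum_add_distrib]
  refine HasDerivAt.fun_sum fun J _ => ?_
  have h := ((hasGDiff_iff_hasDerivAt.1 (hf J)).mul
    (hasGDiff_iff_hasDerivAt.1 (hg (I \ J)))).const_mul (FG.sgn J (I \ J))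
  refine h.congr_deriv ?_
  simp only [zero_smul, add_zero]
  ring

theorem HasGDiff.mul {f g : E → FG} {x y : E} {v w : FG} (hf : HasGDiff f x y v)
    (hg : HasGDiff g x y w) : HasGDiff (fun z => f z * g z) x y (v * g x + f x * w) :=
  hasGDiff_iff_apply.2 fun I => hasGDiff_iff_hasDerivAt.2 (hasDerivAt_apply_mul hf hg I)

theorem HasGDiff.const_mul {g : E → FG} {x y : E} {w : FG} (c : FG)
    (hg : HasGDiff g x y w) : HasGDiff (fun z => c * g z) x y (c * w) := by
  simpa using (hasGDiff_const c x y).mul hg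

theorem HasGDiff.const_smul {g : E → FG} {x y : E} {w : FG} (c : ℝ)
    (hg : HasGDiff g x y w) : HasGDiff (fun z => c • g z) x y (c • w) := by
  have := hg.const_mul (algebraMap ℝ FG c)
  simpa only [← Algebra.smul_def] using this

theorem HasGDiff.sum {ι : Type*} {s : Finset ι} {f : ι → E → FG} {x y : E} {v : ι → FG}
    (hf : ∀ i ∈ s, HasGDiff (f i) x y (v i)) :
    HasGDiff (fun z => ∑ i ∈ s, f i z) x y (∑ i ∈ s, v i) := by
  classical
  induction s using Finset.induction_on with
  | empty => simpa using hasGDiff_const 0 x y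
  | insert i s hi ih =>
    simp only [Finset.sum_insert hi]
    exact (hf i (Finset.mem_insert_self i s)).add
      (ih fun j hj => hf j (Finset.mem_insert_of_mem hj))

theorem HasGDiff.norm_sub_le {f : E → ℂ} {x y : E} {D : E → ℂ} {ε : ℝ}
    (hf : ∀ t ∈ Icc (0 : ℝ) 1, HasGDiff f (x + t • y) y (D (x + t • y)))
    (hD : ∀ t ∈ Icc (0 : ℝ) 1, ‖D (x + t • y)‖ ≤ ε) : ‖f (x + y) - f x‖ ≤ ε := by
  have := norm_image_sub_le_of_norm_deriv_le_segment' (f := fun t : ℝ => f (x + t • y))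
    (f' := fun t => D (x + t • y)) (C := ε) (a := 0) (b := 1)
    (fun t ht => (hf t ht).hasDerivAt.hasDerivWithinAt)
    (fun t ht => hD t (Ico_subset_Icc_self ht)) 1 (right_mem_Icc.2 zero_le_one)
  simpa using this

variable [TopologicalSpace E] [IsTopologicalAddGroup E] [ContinuousSMul ℝ E]

theorem tendsto_line (x y : E) :
    Tendsto (fun t : ℝ => x + t • y) (𝓝 0) (𝓝 x) := by
  have : Continuous fun t : ℝ => x + t • y := by fun_prop
  simpa using this.tendsto 0

theorem HasGDiff.congr_of_eqOn {Y : Type*} [AddCommGroup Y] [Module ℝ Y] [TopologicalSpace Y]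
    {f g : E → Y} {U : Set E} (hU : IsOpen U) {x y : E} (hx : x ∈ U) {v : Y} (h : EqOn f g U)
    (hf : HasGDiff f x y v) : HasGDiff g x y v := by
  refine hf.congr' ?_
  have := ((tendsto_line x y).eventually (hU.mem_nhds hx)).filter_mono
    (nhdsWithin_le_nhds (s := {0}ᶜ))
  filter_upwards [this] with t ht
  rw [h ht, h hx]

/-- Balanced neighbourhoods of `0` form a base. This supplies segments inside `U`, so the mean value
inequality can be used on a space without a norm. -/
theorem exists_balanced_nhds {U : Set E} (hU : IsOpen U) {x : E} (hx : x ∈ U) :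
    ∃ W ∈ 𝓝 x, ∀ z ∈ W, ∀ t ∈ Icc (0 : ℝ) 1, x + t • (z - x) ∈ U := by
  have h0 : (fun y => x + y) ⁻¹' U ∈ 𝓝 (0 : E) := by
    have : Continuous fun y : E => x + y := by fun_prop
    exact this.continuousAt.preimage_mem_nhds (hU.mem_nhds (by simpa using hx))
  obtain ⟨W, ⟨hW, hb⟩, hWU⟩ := (nhds_basis_balanced ℝ E).mem_iff.1 h0
  refine ⟨(fun z => z - x) ⁻¹' W, ?_, fun z hz t ht => hWU (hb t ?_ (smul_mem_smul_set hz))⟩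
  · have : Continuous fun z : E => z - x := by fun_prop
    exact this.continuousAt.preimage_mem_nhds (by simpa using hW)
  · rw [Real.norm_eq_abs, abs_of_nonneg ht.1]
    exact ht.2

/-- A function with jointly continuous Gâteaux differential is continuous. -/
theorem continuousOn_of_hasGDiff {f : E → ℂ} {U : Set E} (hU : IsOpen U) {D : E → E → ℂ}
    (hf : ∀ x ∈ U, ∀ y, HasGDiff f x y (D x y))
    (hD : ContinuousOn (fun p : E × E => D p.1 p.2) (U ×ˢ univ)) : ContinuousOn f U := by
  intro x hx
  refine ContinuousAt.continuousWithinAt (Metric.tendsto_nhds.2 fun ε hε => ?_)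
  -- Linearity of `D x` is not available here. Its vanishing at the zero direction and joint
  -- continuity make `D` small near `(x, 0)`, which is enough for the mean value inequality in the
  -- direction `z - x`.
  have h0 : D x 0 = 0 := (hf x hx 0).unique (hasGDiff_zero_dir f x)
  have hO : (U ×ˢ univ : Set (E × E)) ∈ 𝓝 (x, (0 : E)) :=
    (hU.prod isOpen_univ).mem_nhds ⟨hx, mem_univ _⟩
  have hc : ContinuousAt (fun p : E × E => D p.1 p.2) (x, 0) := hD.continuousAt hO
  have h1 : ∀ᶠ p : E × E in 𝓝 (x, 0), p.1 ∈ U ∧ ‖D p.1 p.2‖ < ε / 2 := by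
    have := Tendsto.eventually_lt_const (u := ε / 2) (by simpa [h0] using hε) hc.norm.tendsto
    filter_upwards [this, hO] with p hp hp'
    exact ⟨hp'.1, hp⟩
  obtain ⟨A, hA, B, hB, hAB⟩ := mem_nhds_prod_iff.1 h1
  obtain ⟨A', hA', hA'o, hxA'⟩ := mem_nhds_iff.1 hA
  obtain ⟨W, hW, hWA⟩ := exists_balanced_nhds hA'o hxA'
  have hB' : (fun z => z - x) ⁻¹' B ∈ 𝓝 x := by
    have : Continuous fun z : E => z - x := by fun_prop
    exact this.continuousAt.preimage_mem_nhds (by simpa using hB)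
  filter_upwards [hW, hB'] with z hz hz'
  have key : ‖f (x + (z - x)) - f x‖ ≤ ε / 2 := by
    refine HasGDiff.norm_sub_le (D := fun w => D w (z - x)) (fun t ht => ?_) (fun t ht => ?_)
    · exact hf _ (hAB (Set.mk_mem_prod (hA' (hWA z hz t ht)) (mem_of_mem_nhds hB))).1 _
    · exact (hAB (Set.mk_mem_prod (hA' (hWA z hz t ht)) hz')).2.le
  rw [add_sub_cancel] at key
  rw [dist_eq_norm]
  linarith

/-- A function whose differentials in the directions `v`, `w` are continuous is strictly
differentiable along the plane spanned by `v`, `w`. -/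
theorem hasStrictFDerivAt_plane {f A B : E → ℂ} {U : Set E} (hU : IsOpen U) {v w : E}
    (hv : ∀ x ∈ U, HasGDiff f x v (A x)) (hw : ∀ x ∈ U, HasGDiff f x w (B x))
    (hA : ContinuousOn A U) (hB : ContinuousOn B U) (x : E) (p : ℝ × ℝ)
    (hp : x + p.1 • v + p.2 • w ∈ U) :
    HasStrictFDerivAt (fun p : ℝ × ℝ => f (x + p.1 • v + p.2 • w))
      (A (x + p.1 • v + p.2 • w) • Complex.ofRealCLM.comp (ContinuousLinearMap.fst ℝ ℝ ℝ) +
        B (x + p.1 • v + p.2 • w) • Complex.ofRealCLM.comp (ContinuousLinearMap.snd ℝ ℝ ℝ)) p := by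
  have hc : Continuous fun p : ℝ × ℝ => x + p.1 • v + p.2 • w := by fun_prop
  have hev : ∀ᶠ q : ℝ × ℝ in 𝓝 p, x + q.1 • v + q.2 • w ∈ U :=
    hc.continuousAt.eventually (hU.mem_nhds hp)
  have key := hasStrictFDerivAt_uncurry_coprod (𝕜 := ℝ) (u := p)
    (f := fun s t : ℝ => f (x + s • v + t • w))
    (f₁ := fun s t => A (x + s • v + t • w) • Complex.ofRealCLM)
    (f₂ := fun s t => B (x + s • v + t • w) • Complex.ofRealCLM) ?_ ?_ ?_ ?_
  · refine key.congr_fderiv ?_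
    ext <;> simp [Function.HasUncurry.uncurry]
  · filter_upwards [hev] with q hq
    have : HasGDiff f ((x + q.2 • w) + q.1 • v) v (A (x + q.1 • v + q.2 • w)) := by
      rw [add_right_comm]
      exact hv _ hq
    have h := this.hasDerivAt.hasFDerivAt
    refine (h.congr_fderiv ?_).congr_of_eventuallyEq ?_
    · ext
      simp [Function.HasUncurry.uncurry]
    · exact Eventually.of_forall fun s => by simp only [add_right_comm]
  · filter_upwards [hev] with q hq
    have h := (hw _ hq).hasDerivAt.hasFDerivAt
    refine h.congr_fderiv ?_
    ext
    simp [Function.HasUncurry.uncurry]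
  · have : ContinuousAt (fun q : ℝ × ℝ => A (x + q.1 • v + q.2 • w)) p :=
      ContinuousAt.comp (g := A) (hA.continuousAt (hU.mem_nhds hp)) hc.continuousAt
    exact this.smul continuousAt_const
  · have : ContinuousAt (fun q : ℝ × ℝ => B (x + q.1 • v + q.2 • w)) p :=
      ContinuousAt.comp (g := B) (hB.continuousAt (hU.mem_nhds hp)) hc.continuousAt
    exact this.smul continuousAt_const

/-- Additivity in the direction is not part of the definition of a Gâteaux differential. It comes
from differentiating along the diagonal of the plane spanned by `v` and `w`, on which the function
is Fréchet differentiable. -/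
theorem HasGDiff.add_dir {f A B : E → ℂ} {U : Set E} (hU : IsOpen U) {v w : E}
    (hv : ∀ x ∈ U, HasGDiff f x v (A x)) (hw : ∀ x ∈ U, HasGDiff f x w (B x))
    (hA : ContinuousOn A U) (hB : ContinuousOn B U) {x : E} (hx : x ∈ U) :
    HasGDiff f x (v + w) (A x + B x) := by
  have h := (hasStrictFDerivAt_plane hU hv hw hA hB x (0, 0) (by simpa using hx)).hasFDerivAt
  have hd : HasDerivAt (fun t : ℝ => (t, t)) ((1 : ℝ), (1 : ℝ)) 0 :=
    (hasDerivAt_id 0).prodMk (hasDerivAt_id 0)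
  have := HasFDerivAt.comp_hasDerivAt (x := (0 : ℝ)) (f := fun t : ℝ => (t, t)) h hd
  rw [hasGDiff_iff_hasDerivAt]
  simpa [Function.comp_def, add_assoc] using this

/-- Restriction to the plane through `x` spanned by `v` and `w` reduces this to the symmetry of the
second derivative of a function on `ℝ²`. -/
theorem HasGDiff.symm {f A B AA AB BA BB : E → ℂ} {U : Set E} (hU : IsOpen U) {v w : E}
    (hv : ∀ x ∈ U, HasGDiff f x v (A x)) (hw : ∀ x ∈ U, HasGDiff f x w (B x))
    (hA : ContinuousOn A U) (hB : ContinuousOn B U)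
    (hAv : ∀ x ∈ U, HasGDiff A x v (AA x)) (hAw : ∀ x ∈ U, HasGDiff A x w (AB x))
    (hBv : ∀ x ∈ U, HasGDiff B x v (BA x)) (hBw : ∀ x ∈ U, HasGDiff B x w (BB x))
    (hAA : ContinuousOn AA U) (hAB : ContinuousOn AB U)
    (hBA : ContinuousOn BA U) (hBB : ContinuousOn BB U) {x : E} (hx : x ∈ U) :
    AB x = BA x := by
  have hx0 : x + (0 : ℝ × ℝ).1 • v + (0 : ℝ × ℝ).2 • w ∈ U := by simpa using hx
  have hc : Continuous fun p : ℝ × ℝ => x + p.1 • v + p.2 • w := by fun_prop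
  have hev : ∀ᶠ q : ℝ × ℝ in 𝓝 0, x + q.1 • v + q.2 • w ∈ U :=
    hc.continuousAt.eventually (hU.mem_nhds hx0)
  have h1 := hev.mono fun q hq => (hasStrictFDerivAt_plane hU hv hw hA hB x q hq).hasFDerivAt
  have h2 := (hasStrictFDerivAt_plane hU hAv hAw hAA hAB x 0 hx0).hasFDerivAt
  have h3 := (hasStrictFDerivAt_plane hU hBv hBw hBA hBB x 0 hx0).hasFDerivAt
  have h4 := (h2.smul_const (Complex.ofRealCLM.comp (ContinuousLinearMap.fst ℝ ℝ ℝ))).add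
    (h3.smul_const (Complex.ofRealCLM.comp (ContinuousLinearMap.snd ℝ ℝ ℝ)))
  have := second_derivative_symmetric_of_eventually h1 h4 (0, 1) (1, 0)
  simpa using this

end

/-- A function on a normed space with continuous linear Gâteaux differential is differentiable. -/
theorem hasFDerivAt_of_hasGDiff {N : Type*} [NormedAddCommGroup N] [NormedSpace ℝ N]
    {g : N → ℂ} {O : Set N} (hO : IsOpen O) {L : N → N →L[ℝ] ℂ}
    (hg : ∀ q ∈ O, ∀ h, HasGDiff g q h (L q h)) (hL : ContinuousOn L O) {q : N} (hq : q ∈ O) :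
    HasFDerivAt g (L q) q := by
  rw [hasFDerivAt_iff_isLittleO, Asymptotics.isLittleO_iff]
  intro ε hε
  have hc := hL.continuousAt (hO.mem_nhds hq)
  have h1 : {z | z ∈ O ∧ ‖L z - L q‖ ≤ ε} ∈ 𝓝 q := by
    filter_upwards [hO.mem_nhds hq, Metric.tendsto_nhds.1 hc ε hε] with z hz hz'
    exact ⟨hz, by rw [← dist_eq_norm]; exact hz'.le⟩
  obtain ⟨A, hA, hAo, hqA⟩ := mem_nhds_iff.1 h1
  obtain ⟨W, hW, hWA⟩ := exists_balanced_nhds hAo hqA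
  filter_upwards [hW] with z hz
  -- Subtracting the linear map `L q` leaves a function whose differential `L p - L q` has norm at
  -- most `ε` near `q`.
  have := HasGDiff.norm_sub_le (f := fun p => g p - L q p) (x := q) (y := z - q)
    (D := fun p => (L p - L q) (z - q)) (ε := ε * ‖z - q‖) (fun t ht => ?_) (fun t ht => ?_)
  · simpa [sub_sub_sub_comm, sub_right_comm] using this
  · have e1 := hasGDiff_iff_hasDerivAt.1 (hg _ (hA (hWA z hz t ht)).1 (z - q))
    have e2 := (L q).hasFDerivAt.comp_hasDerivAt (0 : ℝ)
      (((hasDerivAt_id (0 : ℝ)).smul_const (z - q)).const_add (q + t • (z - q)))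
    refine hasGDiff_iff_hasDerivAt.2 ((e1.sub e2).congr_deriv ?_)
    simp
  · exact ((L _ - L q).le_opNorm _).trans
      (mul_le_mul_of_nonneg_right (hA (hWA z hz t ht)).2 (norm_nonneg _))

/-! ### Topology of the superspace -/

local instance : IsTopologicalAddGroup Rev :=
  inferInstanceAs (IsTopologicalAddGroup (Subalgebra.toSubmodule Rev))

local instance : ContinuousSMul ℝ Rod where
  continuous_smul := by
    refine Continuous.subtype_mk (?_ : Continuous fun p : ℝ × Rod => p.1 • (p.2 : FG)) _
    fun_prop

section

variable {m n : ℕ}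

theorem continuous_even (j : Fin m) : Continuous fun X : SuperSpace m n => (X.1 j : FG) := by
  fun_prop

theorem continuous_odd (k : Fin n) : Continuous fun X : SuperSpace m n => (X.2 k : FG) := by
  fun_prop

end

noncomputable local instance {m n : ℕ} : Module Rev (SuperSpace m n) := Prod.instModule

noncomputable local instance {m n : ℕ} : Module ℝ (SuperSpace m n) := Prod.instModule

noncomputable local instance {m n : ℕ} : SMul Rev (SuperSpace m n) :=
  (inferInstance : Module Rev (SuperSpace m n)).toSMul

local instance {m n : ℕ} : IsTopologicalAddGroup (SuperSpace m n) := Prod.instIsTopologicalAddGroup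

local instance {m n : ℕ} : ContinuousSMul ℝ (SuperSpace m n) := Prod.continuousSMul

/-! ### Linear maps on the superspace -/

section

variable {m n : ℕ}

/-- The `ℜ_ev`-linear map `H ↦ ∑_A H_A F_A`. -/
noncomputable def superLin (F : Fin m → FG) (G : Fin n → FG) : SuperSpace m n →ₗ[Rev] FG where
  toFun H := ∑ j, (H.1 j : FG) * F j + ∑ k, (H.2 k : FG) * G k
  map_add' H H' := by
    simp only [Prod.fst_add, Prod.snd_add, Pi.add_apply, AddMemClass.coe_add,
      add_mul, Finset.sum_add_distrib]
    abel
  map_smul' r H := by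
    simp only [Prod.smul_fst, Prod.smul_snd, Pi.smul_apply, RingHom.id_apply, smul_eq_mul,
      Subalgebra.coe_mul, Rod.coe_smul, Rev.smul_eq, mul_add, Finset.mul_sum, mul_assoc]

theorem superLin_apply (F : Fin m → FG) (G : Fin n → FG) (H : SuperSpace m n) :
    superLin F G H = ∑ j, (H.1 j : FG) * F j + ∑ k, (H.2 k : FG) * G k := rfl

theorem superLin_evenVec (F : Fin m → FG) (G : Fin n → FG) (j : Fin m) (h : Rev) :
    superLin F G (evenVec n j h) = h * F j := by
  rw [superLin_apply, Finset.sum_eq_single j]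
  · simp [evenVec]
  · intro i _ hi
    simp [evenVec, hi]
  · simp

theorem superLin_oddVec (F : Fin m → FG) (G : Fin n → FG) (k : Fin n) (h : Rod) :
    superLin F G (oddVec m k h) = h * G k := by
  rw [superLin_apply, add_comm, Finset.sum_eq_single k]
  · simp [oddVec]
  · intro i _ hi
    simp [oddVec, hi]
  · simp

theorem eq_sum_evenVec_add_sum_oddVec (H : SuperSpace m n) :
    H = ∑ j, evenVec n j (H.1 j) + ∑ k, oddVec m k (H.2 k) := by
  refine Prod.ext ?_ ?_
  · simp [Prod.fst_sum, evenVec, oddVec, Finset.univ_sum_single]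
  · simp [Prod.snd_sum, evenVec, oddVec, Finset.univ_sum_single]

/-- `evenVec` as a linear map. -/
noncomputable def evenLin (n : ℕ) (j : Fin m) : Rev →ₗ[Rev] SuperSpace m n :=
  LinearMap.inl Rev (Fin m → Rev) (Fin n → Rod) ∘ₗ LinearMap.single Rev (fun _ => Rev) j

theorem evenLin_apply (j : Fin m) (h : Rev) : evenLin n j h = evenVec n j h := rfl

/-- `oddVec` as a linear map. -/
noncomputable def oddLin (m : ℕ) {n : ℕ} (k : Fin n) : Rod →ₗ[Rev] SuperSpace m n :=
  LinearMap.inr Rev (Fin m → Rev) (Fin n → Rod) ∘ₗ LinearMap.single Rev (fun _ => Rod) k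

theorem oddLin_apply (k : Fin n) (h : Rod) : oddLin m k h = oddVec m k h := rfl

theorem continuous_evenVec (j : Fin m) : Continuous (evenVec n j) :=
  (continuous_single (A := fun _ : Fin m => Rev) j).prodMk continuous_const

theorem continuous_oddVec (k : Fin n) : Continuous (oddVec m k) :=
  continuous_const.prodMk (continuous_single (A := fun _ : Fin n => Rod) k)

theorem evenVec_add (j : Fin m) (h h' : Rev) :
    evenVec n j (h + h') = evenVec n j h + evenVec n j h' := (evenLin n j).map_add h h'

theorem oddVec_add (k : Fin n) (h h' : Rod) :
    oddVec m k (h + h') = oddVec m k h + oddVec m k h' := (oddLin m k).map_add h h'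

theorem evenVec_smul (j : Fin m) (c : ℝ) (h : Rev) :
    evenVec n j (c • h) = c • evenVec n j h := by
  refine Prod.ext ?_ ?_
  · simp [evenVec, Pi.single_smul']
  · simp [evenVec]

theorem oddVec_smul (k : Fin n) (c : ℝ) (h : Rod) :
    oddVec m k (c • h) = c • oddVec m k h := by
  refine Prod.ext ?_ ?_
  · simp [oddVec]
  · simp [oddVec, Pi.single_smul']

/-- Every `ℜ_ev`-linear map on the superspace has the form `H ↦ ∑_A H_A F_A`. -/
theorem linearMap_eq_superLin (L : SuperSpace m n →ₗ[Rev] FG) :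
    L = superLin (fun j => L (evenVec n j 1))
      (fun k => FG.quot fun i => L (oddVec m k (oddGen i))) := by
  refine LinearMap.ext fun H => ?_
  conv_lhs => rw [eq_sum_evenVec_add_sum_oddVec H]
  rw [map_add, map_sum, map_sum, superLin_apply]
  refine congrArg₂ _ (Finset.sum_congr rfl fun j _ => ?_) (Finset.sum_congr rfl fun k _ => ?_)
  · have : evenVec n j (H.1 j) = H.1 j • evenVec n j 1 := by
      have := (evenLin n j).map_smul (H.1 j) 1
      rwa [smul_eq_mul, mul_one] at this
    rw [this, L.map_smul]
    rfl
  · exact Rod.linearMap_eq_mul (L ∘ₗ oddLin m k) (H.2 k)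

theorem HasGDiff.superLin {F : Fin m → SuperSpace m n → FG} {G : Fin n → SuperSpace m n → FG}
    {F' : Fin m → FG} {G' : Fin n → FG} {X K : SuperSpace m n} (H : SuperSpace m n)
    (hF : ∀ j, HasGDiff (F j) X K (F' j)) (hG : ∀ k, HasGDiff (G k) X K (G' k)) :
    HasGDiff (fun Z => superLin (fun j => F j Z) (fun k => G k Z) H) X K (superLin F' G' H) :=
  (HasGDiff.sum fun j _ => (hF j).const_mul _).add (HasGDiff.sum fun k _ => (hG k).const_mul _)

theorem continuousOn_superLin {α : Type*} [TopologicalSpace α] {s : Set α}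
    {F : Fin m → α → FG} {G : Fin n → α → FG} {H : α → SuperSpace m n}
    (hF : ∀ j, ContinuousOn (F j) s) (hG : ∀ k, ContinuousOn (G k) s) (hH : ContinuousOn H s) :
    ContinuousOn (fun a => superLin (fun j => F j a) (fun k => G k a) (H a)) s := by
  refine (continuousOn_finsetSum _ fun j _ => ?_).add (continuousOn_finsetSum _ fun k _ => ?_)
  · exact ((continuous_even j).comp_continuousOn hH).mul (hF j)
  · exact ((continuous_odd k).comp_continuousOn hH).mul (hG k)

/-- `df (X) H = ∑_A H_A F_A (X)` on `U`. -/
def HasSD (f : SuperSpace m n → FG) (U : Set (SuperSpace m n))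
    (F : Fin m → SuperSpace m n → FG) (G : Fin n → SuperSpace m n → FG) : Prop :=
  ∀ X ∈ U, ∀ H, HasGDiff f X H (superLin (fun j => F j X) (fun k => G k X) H)

end

/-! ### Iterated Gâteaux differentials -/

/-- Each coefficient of the quotient is a fixed sign times one coefficient of one member of the
family, so limits pass through it. -/
theorem FG.hasGDiff_quot {E : Type*} [AddCommGroup E] [Module ℝ E] {g : ℕ → E → FG} {x y : E}
    {v : ℕ → FG} (h : ∀ i, HasGDiff (g i) x y (v i)) :
    HasGDiff (fun z => quot fun i => g i z) x y (quot v) := by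
  refine hasGDiff_iff_apply.2 fun I => hasGDiff_iff_hasDerivAt.2 ?_
  simp only [quot_apply]
  exact (hasGDiff_iff_hasDerivAt.1 (hasGDiff_iff_apply.1 (h _) _)).const_mul _

theorem FG.continuousOn_quot {α : Type*} [TopologicalSpace α] {s : Set α} {g : ℕ → α → FG}
    (h : ∀ i, ContinuousOn (g i) s) : ContinuousOn (fun a => quot fun i => g i a) s := by
  refine continuousOn_iff.2 fun I => ?_
  simp only [quot_apply]
  exact continuousOn_const.mul (continuousOn_iff.1 (h _) _)

section

variable {E : Type*} [AddCommGroup E] [Module ℝ E] [TopologicalSpace E]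

theorem IsCG.congr {Y : Type*} [AddCommGroup Y] [Module ℝ Y] [TopologicalSpace Y] {r : ℕ}
    {f g : E → Y} {U : Set E} (h : IsCG r f U) (hfg : EqOn f g U) : IsCG r g U := by
  obtain ⟨D, h0, h1, h2⟩ := h
  exact ⟨D, fun x hx v => (h0 x hx v).trans (hfg hx), h1, h2⟩

theorem IsCG.quot {r : ℕ} {g : ℕ → E → FG} {U : Set E} (h : ∀ i, IsCG r (g i) U) :
    IsCG r (fun x => FG.quot fun i => g i x) U := by
  choose D h0 h1 h2 using h
  refine ⟨fun k x v => FG.quot fun i => D i k x v, fun x hx v => ?_, fun k hk x hx v w => ?_,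
    fun k hk => ?_⟩
  · simp only [h0 _ x hx v]
  · exact FG.hasGDiff_quot fun i => h1 i k hk x hx v w
  · exact FG.continuousOn_quot fun i => h2 i k hk

/-- New directions are appended at the end, so fixing the first slot of the higher differentials of
`f` gives the iterated differentials of `x ↦ D x y`. This is what makes induction on the order
possible. -/
theorem IsCG.exists_diff {Y : Type*} [AddCommGroup Y] [Module ℝ Y] [TopologicalSpace Y] {r : ℕ}
    {f : E → Y} {U : Set E} (hU : IsOpen U) [IsTopologicalAddGroup E] [ContinuousSMul ℝ E]
    (h : IsCG (r + 1) f U) :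
    ∃ D : E → E → Y, (∀ x ∈ U, ∀ y, HasGDiff f x y (D x y)) ∧
      ContinuousOn (fun p : E × E => D p.1 p.2) (U ×ˢ univ) ∧
      ∀ y, IsCG r (fun x => D x y) U := by
  obtain ⟨D, h0, h1, h2⟩ := h
  have h3 : ∀ x ∈ U, ∀ y, HasGDiff f x y (D 1 x (Fin.cons y Fin.elim0)) := by
    intro x hx y
    have := (h1 0 (Nat.succ_pos r) x hx Fin.elim0 y).congr_of_eqOn hU hx
      (fun z hz => h0 z hz Fin.elim0)
    convert this using 2
    ext i
    fin_cases i
    rfl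
  refine ⟨fun x y => D 1 x (Fin.cons y Fin.elim0), h3, ?_, fun y => ?_⟩
  · refine (h2 1 (by omega)).comp (f := fun p : E × E => (p.1, Fin.cons (α := fun _ => E) p.2
      (Fin.elim0 : Fin 0 → E))) ?_ fun p hp => ⟨hp.1, mem_univ _⟩
    refine Continuous.continuousOn (continuous_fst.prodMk ?_)
    exact Continuous.finCons (A := fun _ => E) continuous_snd continuous_const
  · refine ⟨fun k x v => D (k + 1) x (Fin.cons y v), fun x hx v => ?_, fun k hk x hx v w => ?_,
      fun k hk => ?_⟩
    · congr 2
      exact Subsingleton.elim _ _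
    · have := h1 (k + 1) (by omega) x hx (Fin.cons y v) w
      rwa [← Fin.cons_snoc_eq_snoc_cons] at this
    · refine (h2 (k + 1) (by omega)).comp (f := fun p : E × (Fin k → E) =>
        (p.1, Fin.cons (α := fun _ => E) y p.2)) ?_ fun p hp => ⟨hp.1, mem_univ _⟩
      refine Continuous.continuousOn (continuous_fst.prodMk ?_)
      exact Continuous.finCons (A := fun _ => E) continuous_const continuous_snd

theorem IsCG.continuousOn {Y : Type*} [AddCommGroup Y] [Module ℝ Y] [TopologicalSpace Y] {r : ℕ}
    {f : E → Y} {U : Set E} (h : IsCG r f U) : ContinuousOn f U := by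
  obtain ⟨D, h0, -, h2⟩ := h
  refine ((h2 0 (Nat.zero_le r)).comp (f := fun x : E => (x, (Fin.elim0 : Fin 0 → E)))
    (by fun_prop) fun x hx => ⟨hx, mem_univ _⟩).congr fun x hx => (h0 x hx _).symm

theorem isCGInfty_diff {f g : E → FG} {U : Set E} (hU : IsOpen U) [IsTopologicalAddGroup E]
    [ContinuousSMul ℝ E] (h : IsCGInfty f U) {y : E} (hg : ∀ x ∈ U, HasGDiff f x y (g x)) :
    IsCGInfty g U := by
  intro r
  obtain ⟨D, hD, -, hr⟩ := (h (r + 1)).exists_diff hU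
  exact (hr y).congr fun x hx => (hD x hx y).unique (hg x hx)

/-- The second Gâteaux differential is symmetric. -/
theorem IsCG.hasGDiff_symm {f : E → FG} {U : Set E} (hU : IsOpen U) [IsTopologicalAddGroup E]
    [ContinuousSMul ℝ E] (h : IsCG 2 f U) {v w x : E} {A B : E → FG} {a b : FG} (hx : x ∈ U)
    (hA : ∀ x ∈ U, HasGDiff f x v (A x)) (hB : ∀ x ∈ U, HasGDiff f x w (B x))
    (ha : HasGDiff A x w a) (hb : HasGDiff B x v b) : a = b := by
  obtain ⟨D, hD, -, hr⟩ := h.exists_diff hU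
  have eA : EqOn (fun x => D x v) A U := fun z hz => (hD z hz v).unique (hA z hz)
  have eB : EqOn (fun x => D x w) B U := fun z hz => (hD z hz w).unique (hB z hz)
  obtain ⟨DA, hDA, -, hrA⟩ := ((hr v).congr eA).exists_diff hU
  obtain ⟨DB, hDB, -, hrB⟩ := ((hr w).congr eB).exists_diff hU
  rw [ha.unique (hDA x hx w), hb.unique (hDB x hx v)]
  ext I
  exact HasGDiff.symm (f := fun z => f z I) (A := fun z => A z I) (B := fun z => B z I)
    (AA := fun z => DA z v I) (AB := fun z => DA z w I) (BA := fun z => DB z v I)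
    (BB := fun z => DB z w I) (v := v) (w := w) hU
    (fun z hz => hasGDiff_iff_apply.1 (hA z hz) I) (fun z hz => hasGDiff_iff_apply.1 (hB z hz) I)
    (FG.continuousOn_iff.1 ((hr v).congr eA).continuousOn I)
    (FG.continuousOn_iff.1 ((hr w).congr eB).continuousOn I)
    (fun z hz => hasGDiff_iff_apply.1 (hDA z hz v) I)
    (fun z hz => hasGDiff_iff_apply.1 (hDA z hz w) I)
    (fun z hz => hasGDiff_iff_apply.1 (hDB z hz v) I)
    (fun z hz => hasGDiff_iff_apply.1 (hDB z hz w) I)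
    (FG.continuousOn_iff.1 (hrA v).continuousOn I) (FG.continuousOn_iff.1 (hrA w).continuousOn I)
    (FG.continuousOn_iff.1 (hrB v).continuousOn I) (FG.continuousOn_iff.1 (hrB w).continuousOn I) hx

end

/-! ### Superdifferentiability in terms of the first differential -/

section

variable {m n : ℕ} {U : Set (SuperSpace m n)}

theorem HasSD.evenVec {f : SuperSpace m n → FG} {F : Fin m → SuperSpace m n → FG}
    {G : Fin n → SuperSpace m n → FG} (h : HasSD f U F G) (j : Fin m) {X : SuperSpace m n}
    (hX : X ∈ U) : HasGDiff f X (evenVec n j 1) (F j X) := by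
  have := h X hX (_root_.evenVec n j 1)
  rwa [superLin_evenVec, OneMemClass.coe_one, one_mul] at this

theorem HasSD.oddVec {f : SuperSpace m n → FG} {F : Fin m → SuperSpace m n → FG}
    {G : Fin n → SuperSpace m n → FG} (h : HasSD f U F G) (k : Fin n) (θ : Rod)
    {X : SuperSpace m n} (hX : X ∈ U) : HasGDiff f X (oddVec m k θ) (θ * G k X) := by
  have := h X hX (_root_.oddVec m k θ)
  rwa [superLin_oddVec] at this

theorem FG.quot_gen_mul (X : FG) : (FG.quot fun i => FG.gen i * X) = X := by
  refine FG.eq_of_gen_mul_eq fun i =>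
    FG.gen_mul_quot (L := fun i => FG.gen i * X) (fun i k => ?_) i
  rw [(FG.gen_isOdd i).mul_left_comm (FG.gen_isOdd k), add_neg_cancel]

theorem HasSD.isCGInfty_even (hU : IsOpen U) {f : SuperSpace m n → FG}
    {F : Fin m → SuperSpace m n → FG} {G : Fin n → SuperSpace m n → FG} (h : HasSD f U F G)
    (hf : IsCGInfty f U) (j : Fin m) : IsCGInfty (F j) U :=
  isCGInfty_diff hU hf fun _ hX => h.evenVec j hX

/-- There is no odd unit, so `G k` is not itself a directional derivative of `f`. The products `σ_i
G k` are, and `G k` is their quotient. -/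
theorem HasSD.isCGInfty_odd (hU : IsOpen U) {f : SuperSpace m n → FG}
    {F : Fin m → SuperSpace m n → FG} {G : Fin n → SuperSpace m n → FG} (h : HasSD f U F G)
    (hf : IsCGInfty f U) (k : Fin n) : IsCGInfty (G k) U := by
  intro r
  have h1 : ∀ i, IsCGInfty (fun X => FG.gen i * G k X) U := fun i =>
    isCGInfty_diff hU hf fun X hX => h.oddVec k (oddGen i) hX
  exact (IsCG.quot fun i => h1 i r).congr fun X _ => FG.quot_gen_mul _

theorem hasRevLinearGDiff_of_isGSD_one {f : SuperSpace m n → FG} (h : IsGSD 1 f U) :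
    HasRevLinearGDiff f U := by
  obtain ⟨F, G, -, -, h, -⟩ := h
  exact fun X hX => ⟨superLin (fun j => F j X) (fun k => G k X), h X hX⟩

/-- The coefficients are recovered from derivatives in fixed directions: the even unit vectors and
the odd vectors `σ_i`. Each such derivative is continuous in `X`, and so is their quotient. -/
theorem isGSD_one_of_hasRevLinearGDiff (hU : IsOpen U) {f : SuperSpace m n → FG}
    (hf : IsCG 1 f U) (h : HasRevLinearGDiff f U) : IsGSD 1 f U := by
  choose! L hL using h
  obtain ⟨D, hD, -, hc⟩ := hf.exists_diff hU
  have hcont : ∀ y, ContinuousOn (fun X => L X y) U := fun y =>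
    (hc y).continuousOn.congr fun X hX => (hL X hX y).unique (hD X hX y)
  have hF : ∀ j, ContinuousOn (fun X => L X (evenVec n j 1)) U := fun j => hcont _
  have hG : ∀ k, ContinuousOn (fun X => FG.quot fun i => L X (oddVec m k (oddGen i))) U :=
    fun k => FG.continuousOn_quot fun i => hcont _
  refine ⟨fun j X => L X (evenVec n j 1), fun k X => FG.quot fun i => L X (oddVec m k (oddGen i)),
    hF, hG, fun X hX H => ?_, hF, hG⟩
  have := hL X hX H
  rw [linearMap_eq_superLin (L X)] at this
  exact this

/-- By symmetry the second differential in `v`, `w` may be computed by differentiating `df (·) w`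
along `v`. Since `df (X) w` is `ℜ_ev`-linear in `w` at every point, so is the result, and
specialising `v` isolates a single coefficient. -/
theorem HasSD.hasRevLinearGDiff (hU : IsOpen U) {f : SuperSpace m n → FG}
    {F : Fin m → SuperSpace m n → FG} {G : Fin n → SuperSpace m n → FG} (h : HasSD f U F G)
    (hf : IsCGInfty f U) :
    (∀ j, HasRevLinearGDiff (F j) U) ∧ ∀ k, HasRevLinearGDiff (G k) U := by
  have h2 := hf 2
  obtain ⟨D, hD, -, hc⟩ := h2.exists_diff hU
  have eD : ∀ y, EqOn (fun X => D X y) (fun X => superLin (fun j => F j X) (fun k => G k X) y) U :=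
    fun y X hX => (hD X hX y).unique (h X hX y)
  have h3 : ∀ v, ∃ D2 : SuperSpace m n → SuperSpace m n → FG, ∀ X ∈ U, ∀ w,
      HasGDiff (fun X => superLin (fun j => F j X) (fun k => G k X) v) X w (D2 X w) := fun v => by
    obtain ⟨D2, hD2, -⟩ := ((hc v).congr (eD v)).exists_diff hU
    exact ⟨D2, hD2⟩
  choose D2 hD2 using h3
  have hsymm : ∀ X ∈ U, ∀ v w, D2 v X w = D2 w X v := fun X hX v w =>
    h2.hasGDiff_symm hU hX (fun X hX => h X hX v) (fun X hX => h X hX w) (hD2 v X hX w)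
      (hD2 w X hX v)
  have hadd : ∀ X ∈ U, ∀ v w w', D2 v X (w + w') = D2 v X w + D2 v X w' := by
    intro X hX v w w'
    rw [hsymm X hX, hsymm X hX v w, hsymm X hX v w']
    have h4 := (hD2 w X hX v).add (hD2 w' X hX v)
    simp only [← map_add] at h4
    exact (hD2 (w + w') X hX v).unique h4
  have hsmul : ∀ X ∈ U, ∀ v w, ∀ r : Rev, D2 v X (r • w) = (r : FG) * D2 v X w := by
    intro X hX v w r
    rw [hsymm X hX, hsymm X hX v w]
    have h4 := (hD2 w X hX v).const_mul (r : FG)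
    simp only [← Rev.smul_eq, ← map_smul] at h4
    exact (hD2 (r • w) X hX v).unique h4
  refine ⟨fun j X hX => ⟨⟨⟨D2 (_root_.evenVec n j 1) X, hadd X hX _⟩,
    fun r w => hsmul X hX _ w r⟩, fun H => ?_⟩, fun k X hX => ?_⟩
  · have := hD2 (_root_.evenVec n j 1) X hX H
    simp only [superLin_evenVec, OneMemClass.coe_one, one_mul] at this
    exact this
  · have h5 : ∀ (θ : Rod) H, HasGDiff (fun X => (θ : FG) * G k X) X H
        (D2 (_root_.oddVec m k θ) X H) := by
      intro θ H
      have := hD2 (_root_.oddVec m k θ) X hX H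
      simp only [superLin_oddVec] at this
      exact this
    have h6 : ∀ H, HasGDiff (G k) X H
        (FG.quot fun i => D2 (_root_.oddVec m k (oddGen i)) X H) := by
      intro H
      have := FG.hasGDiff_quot fun i => h5 (oddGen i) H
      exact this.congr_of_eqOn hU hX fun Z _ => FG.quot_gen_mul (G k Z)
    -- Multiplying the differential of `G k` by any odd `θ` gives a second differential of `f`,
    -- whose linearity is known. Odd factors can be cancelled afterwards.
    have h7 : ∀ (θ : Rod) H, (θ : FG) * (FG.quot fun i => D2 (_root_.oddVec m k (oddGen i)) X H) =
        D2 (_root_.oddVec m k θ) X H := fun θ H => ((h6 H).const_mul _).unique (h5 θ H)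
    refine ⟨⟨⟨fun H => FG.quot fun i => D2 (_root_.oddVec m k (oddGen i)) X H, fun H H' => ?_⟩,
      fun r H => ?_⟩, h6⟩
    · refine FG.eq_of_rod_mul_eq fun θ => ?_
      rw [mul_add, h7, h7, h7, hadd X hX]
    · refine FG.eq_of_rod_mul_eq fun θ => ?_
      simp only [RingHom.id_apply, Rev.smul_eq]
      rw [h7, hsmul X hX, ← (isEven_coe r).mul_left_comm, h7]

/-- The coefficients inherit both hypotheses from `f`, so the induction runs over all functions
simultaneously. -/
theorem isGSD_of_isCGInfty (hU : IsOpen U) (r : ℕ) : ∀ f : SuperSpace m n → FG,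
    IsCGInfty f U → IsGSD 1 f U → IsGSD (r + 1) f U := by
  induction r with
  | zero => exact fun f _ h => h
  | succ r ih =>
    rintro f hf ⟨F, G, hF, hG, h, -⟩
    have h' : HasSD f U F G := h
    have hl := h'.hasRevLinearGDiff hU hf
    refine ⟨F, G, hF, hG, h, fun j => ih _ (h'.isCGInfty_even hU hf j) ?_,
      fun k => ih _ (h'.isCGInfty_odd hU hf k) ?_⟩
    · exact isGSD_one_of_hasRevLinearGDiff hU (h'.isCGInfty_even hU hf j 1) (hl.1 j)
    · exact isGSD_one_of_hasRevLinearGDiff hU (h'.isCGInfty_odd hU hf k 1) (hl.2 k)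

theorem HasSD.continuousOn (hU : IsOpen U) {f : SuperSpace m n → FG}
    {F : Fin m → SuperSpace m n → FG} {G : Fin n → SuperSpace m n → FG} (h : HasSD f U F G)
    (hF : ∀ j, ContinuousOn (F j) U) (hG : ∀ k, ContinuousOn (G k) U) : ContinuousOn f U := by
  refine FG.continuousOn_iff.2 fun I => continuousOn_of_hasGDiff hU
    (fun X hX H => hasGDiff_iff_apply.1 (h X hX H) I) ?_
  refine (FG.continuous_apply I).comp_continuousOn (continuousOn_superLin (fun j => ?_)
    (fun k => ?_) continuousOn_snd)
  · exact (hF j).comp continuousOn_fst fun p hp => hp.1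
  · exact (hG k).comp continuousOn_fst fun p hp => hp.1

theorem IsGSD.continuousOn (hU : IsOpen U) {r : ℕ} {f : SuperSpace m n → FG} (h : IsGSD r f U) :
    ContinuousOn f U := by
  cases r with
  | zero => exact h
  | succ r =>
    obtain ⟨F, G, hF, hG, h, -⟩ := h
    exact HasSD.continuousOn hU h hF hG

theorem IsGSD.of_succ (hU : IsOpen U) {r : ℕ} : ∀ {f : SuperSpace m n → FG},
    IsGSD (r + 1) f U → IsGSD r f U := by
  induction r with
  | zero => exact fun h => h.continuousOn hU
  | succ r ih =>
    rintro f ⟨F, G, hF, hG, h, hF', hG'⟩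
    exact ⟨F, G, hF, hG, h, fun j => ih (hF' j), fun k => ih (hG' k)⟩

theorem IsGSD.isCG (hU : IsOpen U) {r : ℕ} : ∀ {f : SuperSpace m n → FG},
    IsGSD r f U → IsCG r f U := by
  induction r with
  | zero =>
    intro f h
    refine ⟨fun k X v => f X, fun _ _ _ => rfl, fun k hk => absurd hk (Nat.not_lt_zero k),
      fun k _ => ?_⟩
    exact ContinuousOn.comp (g := f) h continuousOn_fst fun p hp => hp.1
  | succ r ih =>
    intro f hf
    have hfc := hf.continuousOn hU
    obtain ⟨F, G, hF, hG, h, hF', hG'⟩ := hf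
    choose DF hF0 hF1 hF2 using fun j => ih (hF' j)
    choose DG hG0 hG1 hG2 using fun k => ih (hG' k)
    -- The first direction enters only through `df (X) v₀ = ∑_A (v₀)_A F_A (X)`; all later
    -- directions differentiate the coefficients `F_A`.
    let D : (k : ℕ) → SuperSpace m n → (Fin k → SuperSpace m n) → FG := fun k => match k with
      | 0 => fun X _ => f X
      | k + 1 => fun X v => superLin (fun j => DF j k X (Fin.tail v))
          (fun l => DG l k X (Fin.tail v)) (v 0)
    refine ⟨D, fun _ _ _ => rfl, fun k hk X hX v w => ?_, fun k hk => ?_⟩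
    · cases k with
      | zero =>
        have := h X hX w
        simp only [← hF0 _ X hX (Fin.tail (Fin.snoc (α := fun _ => SuperSpace m n) v w)),
          ← hG0 _ X hX (Fin.tail (Fin.snoc (α := fun _ => SuperSpace m n) v w))] at this
        exact this
      | succ k =>
        change HasGDiff _ X w (superLin
          (fun j => DF j (k + 1) X (Fin.tail (Fin.snoc (α := fun _ => SuperSpace m n) v w)))
          (fun l => DG l (k + 1) X (Fin.tail (Fin.snoc (α := fun _ => SuperSpace m n) v w)))
          (Fin.snoc (α := fun _ => SuperSpace m n) v w (Fin.castSucc 0)))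
        have ht : Fin.tail (Fin.snoc (α := fun _ => SuperSpace m n) v w) =
            Fin.snoc (α := fun _ => SuperSpace m n) (Fin.tail v) w := by
          conv_lhs => rw [← Fin.cons_self_tail v, ← Fin.cons_snoc_eq_snoc_cons, Fin.tail_cons]
        rw [Fin.snoc_castSucc, ht]
        exact HasGDiff.superLin (v 0) (fun j => hF1 j k (by omega) X hX _ w)
          (fun l => hG1 l k (by omega) X hX _ w)
    · cases k with
      | zero => exact ContinuousOn.comp (g := f) hfc continuousOn_fst fun p hp => hp.1
      | succ k =>
        have hc : Continuous fun p : SuperSpace m n × (Fin (k + 1) → SuperSpace m n) =>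
            (p.1, Fin.tail p.2) :=
          continuous_fst.prodMk (continuous_pi fun i => (continuous_apply _).comp continuous_snd)
        refine continuousOn_superLin (fun j => ?_) (fun l => ?_)
          ((continuous_apply (0 : Fin (k + 1))).comp continuous_snd).continuousOn
        · exact (hF2 j k (by omega)).comp hc.continuousOn fun p hp => ⟨hp.1, mem_univ _⟩
        · exact (hG2 l k (by omega)).comp hc.continuousOn fun p hp => ⟨hp.1, mem_univ _⟩

theorem isGSDInfty_iff_isGSD_one (hU : IsOpen U) (f : SuperSpace m n → FG) :
    IsGSDInfty f U ↔ IsCGInfty f U ∧ IsGSD 1 f U := by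
  refine ⟨fun h => ⟨fun r => ?_, h 1 le_rfl⟩, fun h r hr => ?_⟩
  · exact IsGSD.isCG hU ((h (r + 1) (by omega)).of_succ hU)
  · obtain ⟨r, rfl⟩ : ∃ s, r = s + 1 := ⟨r - 1, by omega⟩
    exact isGSD_of_isCGInfty hU r f h.1 h.2

theorem isGSD_one_iff_hasRevLinearGDiff (hU : IsOpen U) (f : SuperSpace m n → FG) :
    IsCGInfty f U ∧ IsGSD 1 f U ↔ IsCGInfty f U ∧ HasRevLinearGDiff f U :=
  ⟨fun h => ⟨h.1, hasRevLinearGDiff_of_isGSD_one h.2⟩,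
    fun h => ⟨h.1, isGSD_one_of_hasRevLinearGDiff hU (h.1 1) h.2⟩⟩

end

/-! ### The Cauchy–Riemann equations -/

theorem FG.hasSum_mono (X : FG) : HasSum (fun I => mono I (X I)) X := by
  refine FG.tendsto_iff.2 fun K => ?_
  simp only [FG.sum_apply]
  have : HasSum (fun I => mono I (X I) K) (mono K (X K) K) :=
    hasSum_single K fun I hI => by rw [mono_apply, if_neg hI.symm]
  rwa [mono_apply, if_pos rfl] at this

theorem FG.mono_isOdd {I : Finset ℕ} (hI : Odd I.card) (c : ℂ) : IsOdd (mono I c) :=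
  (oddMono I hI c).2

theorem FG.mono_empty_one : mono ∅ 1 = (1 : FG) := rfl

theorem FG.mono_eq_smul (I : Finset ℕ) (c : ℂ) : mono I c = c • mono I 1 := by
  rw [← mono_smul, mul_one]

theorem FG.mono_zero (I : Finset ℕ) : mono I 0 = 0 := by
  rw [mono_eq_smul, zero_smul]

/-- The term `h_I σ^I` of `h ∈ ℜ_ev`. -/
noncomputable def Rev.term (h : Rev) (I : Finset ℕ) : Rev :=
  ⟨FG.mono I ((h : FG) I), fun J hJ => by
    rw [FG.mono_apply]
    split_ifs with e
    · exact e ▸ h.2.1 J hJ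
    · rfl, by
    rw [FG.mono_apply]
    split_ifs with e
    · exact e ▸ h.2.2
    · rfl⟩

/-- The term `h_I σ^I` of `h ∈ ℜ_od`. -/
noncomputable def Rod.term (h : Rod) (I : Finset ℕ) : Rod :=
  ⟨FG.mono I ((h : FG) I), fun J hJ => by
    rw [FG.mono_apply]
    split_ifs with e
    · exact e ▸ h.2 J hJ
    · rfl⟩

theorem Rev.hasSum_term (h : Rev) : HasSum (Rev.term h) h := by
  refine tendsto_subtype_rng.2 ?_
  have := FG.hasSum_mono (h : FG)
  refine Tendsto.congr (fun s => ?_) this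
  exact (map_sum Rev.val (Rev.term h) s).symm

theorem Rod.hasSum_term (h : Rod) : HasSum (Rod.term h) h := by
  refine tendsto_subtype_rng.2 ?_
  have := FG.hasSum_mono (h : FG)
  refine Tendsto.congr (fun s => ?_) this
  exact (map_sum Rod.subtype (Rod.term h) s).symm

theorem HasComplexDerivAtZero.hasGDiff {g : ℂ → FG} {v : FG} (h : HasComplexDerivAtZero g v)
    (c : ℂ) : HasGDiff g 0 c (c • v) := by
  rcases eq_or_ne c 0 with rfl | hc
  · rw [zero_smul]
    exact hasGDiff_zero_dir g 0
  · have h1 : Tendsto (fun t : ℝ => (t : ℂ) * c) (𝓝[≠] 0) (𝓝[≠] 0) := by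
      refine tendsto_nhdsWithin_iff.2 ⟨?_, ?_⟩
      · have : Continuous fun t : ℝ => (t : ℂ) * c := by fun_prop
        have := this.tendsto 0
        rw [Complex.ofReal_zero, zero_mul] at this
        exact this.mono_left nhdsWithin_le_nhds
      · filter_upwards [self_mem_nhdsWithin] with t ht
        simpa [hc] using ht
    refine ((Tendsto.comp h h1).const_smul c).congr fun t => ?_
    simp only [Function.comp, smul_smul, mul_inv, zero_add]
    rw [mul_comm (t : ℂ)⁻¹, ← mul_assoc, mul_inv_cancel₀ hc, one_mul, Complex.real_smul]
    ext I
    simp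

section

variable {E : Type*} [AddCommGroup E] [Module ℝ E] [TopologicalSpace E] [IsTopologicalAddGroup E]

/-- A continuous differential that is complex linear along a complex line is a complex
derivative. -/
theorem hasComplexDerivAtZero_of_hasGDiff {f B : E → FG} {U : Set E} (hU : IsOpen U) (ι : ℂ →ₗ[ℝ] E)
    (hι : Continuous ι) (hf : ∀ x ∈ U, ∀ c, HasGDiff f x (ι c) (c • B x)) (hB : ContinuousOn B U)
    {x : E} (hx : x ∈ U) : HasComplexDerivAtZero (fun t => f (x + ι t)) (B x) := by
  have hc : Continuous fun t => x + ι t := continuous_const.add hι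
  refine FG.tendsto_iff.2 fun K => ?_
  have h1 := hasFDerivAt_of_hasGDiff (g := fun t : ℂ => f (x + ι t) K)
    (O := (fun t => x + ι t) ⁻¹' U) (hU.preimage hc)
    (L := fun t => B (x + ι t) K • (1 : ℂ →L[ℝ] ℂ)) (fun t ht c => ?_) ?_ (q := 0)
    (by simpa using hx)
  · have h2 : HasFDerivAt (fun t : ℂ => f (x + ι t) K) (B x K • (1 : ℂ →L[ℂ] ℂ)) 0 := by
      refine hasFDerivAt_of_restrictScalars ℝ h1 ?_
      ext
      simp
    have h3 := hasDerivAt_iff_tendsto_slope_zero.1 h2.hasDerivAt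
    simpa using h3
  · have h2 := hasGDiff_iff_apply.1 (hf _ ht c) K
    have e : B (x + ι t) K * c = (c • B (x + ι t)) K := by
      rw [FG.smul_apply, mul_comm]
    change HasGDiff _ t c (B (x + ι t) K * c)
    rw [e]
    unfold HasGDiff at h2 ⊢
    refine h2.congr fun s => ?_
    simp only [map_add, map_smul, add_assoc]
  · exact ((FG.continuousOn_iff.1 hB K).comp hc.continuousOn fun t ht => ht).smul
      continuousOn_const

end

section

variable {m n : ℕ} {U : Set (SuperSpace m n)}

theorem continuous_mono (I : Finset ℕ) : Continuous (FG.mono I) := by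
  refine FG.continuous_iff.2 fun J => ?_
  simp only [FG.mono_apply]
  split_ifs
  · exact continuous_id
  · exact continuous_const

/-- The complex coordinate line `t ↦ t σ^I` in the `j`-th even direction. -/
noncomputable def evenLine (n : ℕ) (j : Fin m) (I : Finset ℕ) (hI : Even I.card) (h0 : I ≠ ∅) :
    ℂ →ₗ[ℝ] SuperSpace m n where
  toFun c := evenVec n j (evenMono I hI h0 c)
  map_add' c d := by
    rw [← evenVec_add]
    congr 1
    refine Subtype.ext ?_
    change FG.mono I (c + d) = FG.mono I c + FG.mono I d
    rw [FG.mono_eq_smul, add_smul, ← FG.mono_eq_smul, ← FG.mono_eq_smul]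
  map_smul' c d := by
    rw [RingHom.id_apply, ← evenVec_smul]
    congr 1
    refine Subtype.ext ?_
    change FG.mono I (c * d) = c • FG.mono I d
    rw [FG.mono_smul]
    rfl

/-- The complex coordinate line `t ↦ t σ^I` in the `k`-th odd direction. -/
noncomputable def oddLine (m : ℕ) {n : ℕ} (k : Fin n) (I : Finset ℕ) (hI : Odd I.card) :
    ℂ →ₗ[ℝ] SuperSpace m n where
  toFun c := oddVec m k (oddMono I hI c)
  map_add' c d := by
    rw [← oddVec_add]
    congr 1
    refine Subtype.ext ?_
    change FG.mono I (c + d) = FG.mono I c + FG.mono I d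
    rw [FG.mono_eq_smul, add_smul, ← FG.mono_eq_smul, ← FG.mono_eq_smul]
  map_smul' c d := by
    rw [RingHom.id_apply, ← oddVec_smul]
    congr 1
    refine Subtype.ext ?_
    change FG.mono I (c * d) = c • FG.mono I d
    rw [FG.mono_smul]
    rfl

/-- The partial derivatives are `σ^I F_j` and `σ^J G_k`; continuity of the coefficients promotes
real directional derivatives to complex ones. The odd equations then express that `σ^J` and `σ^K`
anticommute. -/
theorem cauchyRiemann_of_isGSD_one (hU : IsOpen U) {f : SuperSpace m n → FG}
    (h : IsGSD 1 f U) : CauchyRiemann f U := by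
  obtain ⟨F, G, hF, hG, h, -⟩ := h
  have h' : HasSD f U F G := h
  intro X hX
  refine ⟨fun j I => FG.mono I 1 * F j X, fun k J => FG.mono J 1 * G k X, fun j => ?_,
    fun j I hI h0 => ?_, fun k J hJ => ?_, fun j I _ => ?_, fun k J K hJ hK => ?_⟩
  · simp only
    rw [FG.mono_empty_one, one_mul]
    exact h'.evenVec j hX
  · refine hasComplexDerivAtZero_of_hasGDiff (B := fun X => FG.mono I 1 * F j X) hU
      (evenLine n j I hI h0) ?_ (fun X hX c => ?_) (continuousOn_const.mul (hF j)) hX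
    · exact (continuous_evenVec j).comp ((continuous_mono I).subtype_mk _)
    · have := h' X hX (evenVec n j (evenMono I hI h0 c))
      rw [superLin_evenVec] at this
      rw [← smul_mul_assoc, ← FG.mono_eq_smul]
      exact this
  · refine hasComplexDerivAtZero_of_hasGDiff (B := fun X => FG.mono J 1 * G k X) hU
      (oddLine m k J hJ) ?_ (fun X hX c => ?_) (continuousOn_const.mul (hG k)) hX
    · exact (continuous_oddVec k).comp ((continuous_mono J).subtype_mk _)
    · have := h' X hX (oddVec m k (oddMono J hJ c))
      rw [superLin_oddVec] at this
      rw [← smul_mul_assoc, ← FG.mono_eq_smul]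
      exact this
  · simp only
    rw [FG.mono_empty_one, one_mul]
  · simp only
    rw [(FG.mono_isOdd hK 1).mul_left_comm (FG.mono_isOdd hJ 1), neg_add_cancel]

/-- The equations determine `df (X)` on the monomials `c σ^I` in each coordinate. As `df (X)` is
additive and continuous, its values on the convergent sums of such monomials follow. -/
theorem hasRevLinearGDiff_of_cauchyRiemann (hU : IsOpen U) {f : SuperSpace m n → FG}
    (hf : IsCG 1 f U) (h : CauchyRiemann f U) : HasRevLinearGDiff f U := by
  obtain ⟨D, hD, hDc, hc⟩ := hf.exists_diff hU
  intro X hX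
  obtain ⟨P, Q, hP, hPc, hQc, hPeq, hQeq⟩ := h X hX
  have hadd : ∀ v w, D X (v + w) = D X v + D X w := by
    intro v w
    ext I
    exact (hasGDiff_iff_apply.1 (hD X hX (v + w)) I).unique <|
      HasGDiff.add_dir (A := fun Z => D Z v I) (B := fun Z => D Z w I) hU
        (fun Z hZ => hasGDiff_iff_apply.1 (hD Z hZ v) I)
        (fun Z hZ => hasGDiff_iff_apply.1 (hD Z hZ w) I)
        (FG.continuousOn_iff.1 (hc v).continuousOn I)
        (FG.continuousOn_iff.1 (hc w).continuousOn I) hX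
  have hcont : Continuous (D X) := by
    rw [← continuousOn_univ]
    exact hDc.comp (f := fun y => (X, y)) (by fun_prop) fun y _ => ⟨hX, mem_univ _⟩
  let DX : SuperSpace m n →+ FG := AddMonoidHom.mk' (D X) hadd
  have hline : ∀ (ι : ℂ →ₗ[ℝ] SuperSpace m n) (v : FG),
      HasComplexDerivAtZero (fun t => f (X + ι t)) v → ∀ c, D X (ι c) = c • v := by
    intro ι v hv c
    refine (hD X hX (ι c)).unique ((hv.hasGDiff c).congr fun t => ?_)
    simp only [zero_add, map_smul, map_zero, add_zero]
  have heven : ∀ j (x : Rev), D X (evenVec n j x) = (x : FG) * P j ∅ := by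
    intro j x
    have h1 : HasSum (fun I => DX (evenVec n j (Rev.term x I))) (DX (evenVec n j x)) :=
      (Rev.hasSum_term x).map (DX.comp (evenLin n j).toAddMonoidHom)
        (hcont.comp (continuous_evenVec j))
    have h2 : HasSum (fun I => ((Rev.term x I : Rev) : FG) * P j ∅) ((x : FG) * P j ∅) :=
      (FG.hasSum_mono (x : FG)).mul_right _
    suffices hs : ∀ I, DX (evenVec n j (Rev.term x I)) =
        ((Rev.term x I : Rev) : FG) * P j ∅ by
      simp only [hs] at h1
      exact h1.unique h2
    intro I
    rcases Nat.even_or_odd I.card with hI | hI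
    · rcases eq_or_ne I ∅ with rfl | h0
      -- The body coordinate is real, so the real derivative in the direction `1` suffices for this
      -- term.
      · have e : Rev.term x ∅ = ((x : FG) ∅).re • (1 : Rev) := by
          refine Subtype.ext ?_
          change FG.mono ∅ ((x : FG) ∅) = ((x : FG) ∅).re • FG.mono ∅ 1
          rw [FG.mono_eq_smul]
          conv_lhs => rw [← Complex.re_add_im ((x : FG) ∅), x.2.2]
          ext J
          simp
        rw [e, evenVec_smul]
        refine ((hD X hX _).unique ((hP j).smul_dir _)).trans ?_
        rw [Rev.coe_real_smul, smul_mul_assoc]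
        exact congrArg _ (one_mul _).symm
      · refine (hline (evenLine n j I hI h0) _ (hPc j I hI h0) ((x : FG) I)).trans ?_
        rw [hPeq j I hI, ← smul_mul_assoc, ← FG.mono_eq_smul]
        rfl
    · have e : Rev.term x I = 0 := by
        refine Subtype.ext ?_
        change FG.mono I ((x : FG) I) = 0
        rw [x.2.1 I hI, FG.mono_zero]
      rw [e, ← evenLin_apply, map_zero, map_zero]
      exact (zero_mul _).symm
  -- With `G` the quotient of the `Q k {i}`, the equations give `σ_i Q k J = -σ^J Q k {i} = -σ^J σ_i
  -- G = σ_i σ^J G`, and `σ_i` cancels since `i` is arbitrary.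
  have hQgen : ∀ k J, Odd J.card → Q k J = FG.mono J 1 * FG.quot fun i => Q k {i} := by
    intro k J hJ
    refine FG.eq_of_gen_mul_eq fun i => ?_
    have hg := FG.gen_mul_quot (L := fun i => Q k {i})
      (fun i l => hQeq k {i} {l} (by simp) (by simp)) i
    rw [(FG.gen_isOdd i).mul_left_comm (FG.mono_isOdd hJ 1), hg]
    exact eq_neg_of_add_eq_zero_left (hQeq k J {i} hJ (by simp))
  have hodd : ∀ k (θ : Rod), D X (oddVec m k θ) = (θ : FG) * FG.quot fun i => Q k {i} := by
    intro k θ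
    have h1 : HasSum (fun I => DX (oddVec m k (Rod.term θ I))) (DX (oddVec m k θ)) :=
      (Rod.hasSum_term θ).map (DX.comp (oddLin m k).toAddMonoidHom)
        (hcont.comp (continuous_oddVec k))
    have h2 : HasSum (fun I => ((Rod.term θ I : Rod) : FG) * FG.quot fun i => Q k {i})
        ((θ : FG) * FG.quot fun i => Q k {i}) :=
      (FG.hasSum_mono (θ : FG)).mul_right _
    suffices hs : ∀ I, DX (oddVec m k (Rod.term θ I)) =
        ((Rod.term θ I : Rod) : FG) * FG.quot fun i => Q k {i} by
      simp only [hs] at h1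
      exact h1.unique h2
    intro I
    rcases Nat.even_or_odd I.card with hI | hI
    · have e : Rod.term θ I = 0 := by
        refine Subtype.ext ?_
        change FG.mono I ((θ : FG) I) = 0
        rw [θ.2 I hI, FG.mono_zero]
      rw [e, ← oddLin_apply, map_zero, map_zero]
      exact (zero_mul _).symm
    · refine (hline (oddLine m k I hI) _ (hQc k I hI) ((θ : FG) I)).trans ?_
      rw [hQgen k I hI, ← smul_mul_assoc, ← FG.mono_eq_smul]
      rfl
  refine ⟨superLin (fun j => P j ∅) (fun k => FG.quot fun i => Q k {i}), fun H => ?_⟩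
  have : D X H = superLin (fun j => P j ∅) (fun k => FG.quot fun i => Q k {i}) H := by
    conv_lhs => rw [eq_sum_evenVec_add_sum_oddVec H]
    change DX _ = _
    rw [map_add, map_sum, map_sum, superLin_apply]
    exact congrArg₂ _ (Finset.sum_congr rfl fun j _ => heven j _)
      (Finset.sum_congr rfl fun k _ => hodd k _)
  rw [← this]
  exact hD X hX H

end

/-! ### Equivalence of the differentiability conditions -/

theorem tfae_isGSDInfty {m n : ℕ} {U : Set (SuperSpace m n)} (hU : IsOpen U)
    (f : SuperSpace m n → FG) :
    List.TFAE [IsGSDInfty f U,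
      IsCGInfty f U ∧ IsGSD 1 f U,
      IsCGInfty f U ∧ HasRevLinearGDiff f U,
      IsCGInfty f U ∧ CauchyRiemann f U] := by
  tfae_have 1 ↔ 2 := isGSDInfty_iff_isGSD_one hU f
  tfae_have 2 ↔ 3 := isGSD_one_iff_hasRevLinearGDiff hU f
  tfae_have 2 → 4 := fun h => ⟨h.1, cauchyRiemann_of_isGSD_one hU h.2⟩
  tfae_have 4 → 3 := fun h => ⟨h.1, hasRevLinearGDiff_of_cauchyRiemann hU (h.1 1) h.2⟩
  tfae_finish

/-! ### Partial derivatives of smooth functions on an open set -/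

section

variable {m : ℕ} {V : Set (Fin m → ℝ)} {g h : (Fin m → ℝ) → ℂ}

theorem partialD_contDiffOn (hV : IsOpen V) (hg : ContDiffOn ℝ ∞ g V) (j : Fin m) :
    ContDiffOn ℝ ∞ (partialD j g) V :=
  (hg.fderiv_of_isOpen hV le_rfl).clm_apply contDiffOn_const

theorem ContDiffOn.differentiableAt_of_isOpen (hV : IsOpen V) (hg : ContDiffOn ℝ ∞ g V)
    {q : Fin m → ℝ} (hq : q ∈ V) : DifferentiableAt ℝ g q :=
  (hg.differentiableOn (by simp)).differentiableAt (hV.mem_nhds hq)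

theorem partialD_congr (hV : IsOpen V) (hgh : EqOn g h V) (j : Fin m) :
    EqOn (partialD j g) (partialD j h) V := fun q hq => by
  unfold partialD
  rw [(hgh.eventuallyEq_of_mem (hV.mem_nhds hq)).fderiv_eq]

theorem partialD_add (hV : IsOpen V) (hg : ContDiffOn ℝ ∞ g V) (hh : ContDiffOn ℝ ∞ h V)
    (j : Fin m) :
    EqOn (partialD j fun q => g q + h q) (fun q => partialD j g q + partialD j h q) V :=
  fun q hq => by
    unfold partialD
    rw [fderiv_fun_add (hg.differentiableAt_of_isOpen hV hq) (hh.differentiableAt_of_isOpen hV hq)]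
    rfl

theorem partialD_const_mul (hV : IsOpen V) (hg : ContDiffOn ℝ ∞ g V) (c : ℂ) (j : Fin m) :
    EqOn (partialD j fun q => c * g q) (fun q => c * partialD j g q) V :=
  fun q hq => by
    unfold partialD
    rw [fderiv_const_mul (hg.differentiableAt_of_isOpen hV hq)]
    rfl

theorem partialD_comm (hV : IsOpen V) (hg : ContDiffOn ℝ ∞ g V) (i j : Fin m) :
    EqOn (partialD i (partialD j g)) (partialD j (partialD i g)) V := by
  have key : ∀ i j, ∀ q ∈ V, partialD i (partialD j g) q =
      fderiv ℝ (fderiv ℝ g) q (Pi.single i 1) (Pi.single j 1) := by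
    intro i j q hq
    have hd : DifferentiableAt ℝ (fderiv ℝ g) q :=
      ((hg.fderiv_of_isOpen (m := ∞) hV le_rfl).differentiableOn (by simp)).differentiableAt
        (hV.mem_nhds hq)
    change fderiv ℝ (fun q => fderiv ℝ g q (Pi.single j 1)) q _ = _
    rw [fderiv_clm_apply hd (differentiableAt_const _)]
    simp
  intro q hq
  rw [key i j q hq, key j i q hq]
  exact second_derivative_symmetric_of_eventually (𝕜 := ℝ)
    (by
      filter_upwards [hV.mem_nhds hq] with p hp
      exact (hg.differentiableAt_of_isOpen hV hp).hasFDerivAt)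
    (((hg.fderiv_of_isOpen (m := ∞) hV le_rfl).differentiableOn (by simp)).differentiableAt
        (hV.mem_nhds hq)).hasFDerivAt _ _

theorem iterate_partialD_contDiffOn (hV : IsOpen V) (hg : ContDiffOn ℝ ∞ g V) (j : Fin m) (k : ℕ) :
    ContDiffOn ℝ ∞ ((partialD j)^[k] g) V := by
  induction k with
  | zero => exact hg
  | succ k ih =>
    rw [Function.iterate_succ_apply']
    exact partialD_contDiffOn hV ih j

theorem iterate_partialD_congr (hV : IsOpen V) (hgh : EqOn g h V) (j : Fin m) (k : ℕ) :
    EqOn ((partialD j)^[k] g) ((partialD j)^[k] h) V := by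
  induction k with
  | zero => exact hgh
  | succ k ih =>
    rw [Function.iterate_succ_apply', Function.iterate_succ_apply']
    exact partialD_congr hV ih j

theorem iterate_partialD_add (hV : IsOpen V) (hg : ContDiffOn ℝ ∞ g V) (hh : ContDiffOn ℝ ∞ h V)
    (j : Fin m) (k : ℕ) : EqOn ((partialD j)^[k] fun q => g q + h q)
      (fun q => (partialD j)^[k] g q + (partialD j)^[k] h q) V := by
  induction k with
  | zero => exact fun _ _ => rfl
  | succ k ih =>
    simp only [Function.iterate_succ_apply']
    exact (partialD_congr hV ih j).trans (partialD_add hV (iterate_partialD_contDiffOn hV hg j k)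
      (iterate_partialD_contDiffOn hV hh j k) j)

theorem iterate_partialD_const_mul (hV : IsOpen V) (hg : ContDiffOn ℝ ∞ g V) (c : ℂ)
    (j : Fin m) (k : ℕ) : EqOn ((partialD j)^[k] fun q => c * g q)
      (fun q => c * (partialD j)^[k] g q) V := by
  induction k with
  | zero => exact fun _ _ => rfl
  | succ k ih =>
    simp only [Function.iterate_succ_apply']
    exact (partialD_congr hV ih j).trans
      (partialD_const_mul hV (iterate_partialD_contDiffOn hV hg j k) c j)

theorem iterate_partialD_comm (hV : IsOpen V) (hg : ContDiffOn ℝ ∞ g V) (i j : Fin m) (k : ℕ) :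
    EqOn ((partialD i)^[k] (partialD j g)) (partialD j ((partialD i)^[k] g)) V := by
  induction k with
  | zero => exact fun _ _ => rfl
  | succ k ih =>
    simp only [Function.iterate_succ_apply']
    exact (partialD_congr hV ih i).trans
      (partialD_comm hV (iterate_partialD_contDiffOn hV hg i k) i j)

/-- The iterated partial derivative along a list of coordinates. -/
noncomputable def listD (l : List (Fin m)) (α : Fin m → ℕ) (g : (Fin m → ℝ) → ℂ) :
    (Fin m → ℝ) → ℂ :=
  l.foldr (fun j h => (partialD j)^[α j] h) g

theorem listD_cons (i : Fin m) (l : List (Fin m)) (α : Fin m → ℕ) (g : (Fin m → ℝ) → ℂ) :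
    listD (i :: l) α g = (partialD i)^[α i] (listD l α g) := rfl

theorem listD_contDiffOn (hV : IsOpen V) (hg : ContDiffOn ℝ ∞ g V) (l : List (Fin m))
    (α : Fin m → ℕ) : ContDiffOn ℝ ∞ (listD l α g) V := by
  induction l with
  | nil => exact hg
  | cons i l ih => exact iterate_partialD_contDiffOn hV ih i _

theorem listD_add (hV : IsOpen V) (hg : ContDiffOn ℝ ∞ g V) (hh : ContDiffOn ℝ ∞ h V)
    (l : List (Fin m)) (α : Fin m → ℕ) :
    EqOn (listD l α fun q => g q + h q) (fun q => listD l α g q + listD l α h q) V := by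
  induction l with
  | nil => exact fun _ _ => rfl
  | cons i l ih =>
    simp only [listD_cons]
    exact (iterate_partialD_congr hV ih i _).trans (iterate_partialD_add hV
      (listD_contDiffOn hV hg l α) (listD_contDiffOn hV hh l α) i _)

theorem listD_const_mul (hV : IsOpen V) (hg : ContDiffOn ℝ ∞ g V) (c : ℂ) (l : List (Fin m))
    (α : Fin m → ℕ) : EqOn (listD l α fun q => c * g q) (fun q => c * listD l α g q) V := by
  induction l with
  | nil => exact fun _ _ => rfl
  | cons i l ih =>
    simp only [listD_cons]
    exact (iterate_partialD_congr hV ih i _).trans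
      (iterate_partialD_const_mul hV (listD_contDiffOn hV hg l α) c i _)

theorem listD_partialD (hV : IsOpen V) (hg : ContDiffOn ℝ ∞ g V) (l : List (Fin m))
    (α : Fin m → ℕ) (j : Fin m) :
    EqOn (listD l α (partialD j g)) (partialD j (listD l α g)) V := by
  induction l with
  | nil => exact fun _ _ => rfl
  | cons i l ih =>
    simp only [listD_cons]
    exact (iterate_partialD_congr hV ih i _).trans
      (iterate_partialD_comm hV (listD_contDiffOn hV hg l α) i j _)

theorem listD_congr_exponent {l : List (Fin m)} {α β : Fin m → ℕ} (h : ∀ i ∈ l, α i = β i)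
    (g : (Fin m → ℝ) → ℂ) : listD l α g = listD l β g := by
  induction l with
  | nil => rfl
  | cons i l ih =>
    rw [listD_cons, listD_cons, h i (by simp), ih fun k hk => h k (by simp [hk])]

/-- The additional `∂_j` is moved to the front past the other coordinates. Absence of repetitions
ensures that the raised exponent is used only once. -/
theorem listD_update (hV : IsOpen V) (hg : ContDiffOn ℝ ∞ g V) {l : List (Fin m)} (hl : l.Nodup)
    (α : Fin m → ℕ) {j : Fin m} (hj : j ∈ l) :
    EqOn (listD l (Function.update α j (α j + 1)) g) (partialD j (listD l α g)) V := by
  induction l with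
  | nil => simp at hj
  | cons i l ih =>
    obtain ⟨hi, hl⟩ := List.nodup_cons.1 hl
    simp only [listD_cons]
    rcases eq_or_ne j i with rfl | hji
    · rw [listD_congr_exponent (β := α), Function.update_self, Function.iterate_succ_apply']
      · exact fun _ _ => rfl
      · intro k hk
        exact Function.update_of_ne (by rintro rfl; exact hi hk) _ _
    · rw [Function.update_of_ne hji.symm]
      exact (iterate_partialD_congr hV (ih hl ((List.mem_cons.1 hj).resolve_left hji)) i _).trans
        (iterate_partialD_comm hV (listD_contDiffOn hV hg l α) i j _)

theorem multiD_eq_listD (α : Fin m → ℕ) (g : (Fin m → ℝ) → ℂ) :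
    multiD α g = listD (List.finRange m) α g := rfl

end

/-! ### Partial derivatives of `ℭ`-valued functions -/

section

variable {m : ℕ} {V : Set (Fin m → ℝ)} {u v : (Fin m → ℝ) → FG}

/-- The partial derivative of a function with values in `ℭ`. -/
noncomputable def partialFG (j : Fin m) (u : (Fin m → ℝ) → FG) : (Fin m → ℝ) → FG :=
  fun q J => partialD j (fun p => u p J) q

theorem SmoothOnFG.partialFG (hV : IsOpen V) (hu : SmoothOnFG u V) (j : Fin m) :
    SmoothOnFG (partialFG j u) V := fun J => partialD_contDiffOn hV (hu J) j

theorem multiDFG_update (hV : IsOpen V) (hu : SmoothOnFG u V) (α : Fin m → ℕ) (j : Fin m)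
    {q : Fin m → ℝ} (hq : q ∈ V) :
    multiDFG (Function.update α j (α j + 1)) u q = multiDFG α (partialFG j u) q := by
  ext J
  exact (listD_update hV (hu J) (List.nodup_finRange m) α (List.mem_finRange j) hq).trans
    (listD_partialD hV (hu J) _ α j hq).symm

theorem multiDFG_add (hV : IsOpen V) (hu : SmoothOnFG u V) (hv : SmoothOnFG v V) (α : Fin m → ℕ)
    {q : Fin m → ℝ} (hq : q ∈ V) :
    multiDFG α (fun q => u q + v q) q = multiDFG α u q + multiDFG α v q := by
  ext J
  exact listD_add hV (hu J) (hv J) _ α hq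

theorem multiDFG_smul (hV : IsOpen V) (hu : SmoothOnFG u V) (c : ℂ) (α : Fin m → ℕ)
    {q : Fin m → ℝ} (hq : q ∈ V) :
    multiDFG α (fun q => c • u q) q = c • multiDFG α u q := by
  ext J
  exact listD_const_mul hV (hu J) c _ α hq

theorem multiDFG_zero (u : (Fin m → ℝ) → FG) (q : Fin m → ℝ) : multiDFG 0 u q = u q := by
  ext J
  have : ∀ l : List (Fin m), listD l 0 (fun p => u p J) = fun p => u p J := by
    intro l
    induction l with
    | nil => rfl
    | cons i l ih =>
      rw [listD_cons, ih]
      rfl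
  exact congrFun (this _) q

theorem SmoothOnFG.add (hu : SmoothOnFG u V) (hv : SmoothOnFG v V) :
    SmoothOnFG (fun q => u q + v q) V := fun J => (hu J).add (hv J)

theorem SmoothOnFG.smul (hu : SmoothOnFG u V) (c : ℂ) :
    SmoothOnFG (fun q => c • u q) V := fun J => contDiffOn_const.mul (hu J)

theorem smoothOnFG_zero : SmoothOnFG (fun _ => 0) V := fun _ => contDiffOn_const

end

/-! ### Termwise differentiation of locally finite series -/

theorem FG.hasSum_apply {ι : Type*} {a : ι → FG} {X : FG} (h : HasSum a X) {I : Finset ℕ}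
    {s : Finset ι}
    (hs : ∀ i ∉ s, a i I = 0) : X I = ∑ i ∈ s, a i I := by
  have h1 : HasSum (fun i => a i I) (X I) := by
    have := (FG.tendsto_iff.1 h) I
    simp only [FG.sum_apply] at this
    exact this
  exact h1.unique (hasSum_sum_of_ne_finset_zero hs)

/-- The finite set of relevant indices depends on the coefficient `I` but not on the point, so every
coefficient of `F` is one fixed finite sum. -/
theorem continuousOn_of_hasSum {E ι : Type*} [TopologicalSpace E] {f : ι → E → FG} {F : E → FG}
    {U : Set E}
    (hF : ∀ z, HasSum (fun i => f i z) (F z))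
    (hfin : ∀ I, ∃ s : Finset ι, ∀ i ∉ s, ∀ z, f i z I = 0) (hf : ∀ i, ContinuousOn (f i) U) :
    ContinuousOn F U := by
  refine FG.continuousOn_iff.2 fun I => ?_
  obtain ⟨s, hs⟩ := hfin I
  simp only [FG.hasSum_apply (hF _) fun i hi => hs i hi _]
  exact continuousOn_finsetSum _ fun i _ => FG.continuousOn_iff.1 (hf i) I

section

variable {E ι : Type*} [AddCommGroup E] [Module ℝ E] {f : ι → E → FG} {F : E → FG}

theorem hasGDiff_of_hasSum (hF : ∀ z, HasSum (fun i => f i z) (F z))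
    (hfin : ∀ I, ∃ s : Finset ι, ∀ i ∉ s, ∀ z, f i z I = 0) {x y : E} {f' : ι → FG} {S : FG}
    (hf : ∀ i, HasGDiff (f i) x y (f' i)) (hS : HasSum f' S) : HasGDiff F x y S := by
  refine hasGDiff_iff_apply.2 fun I => ?_
  obtain ⟨s, hs⟩ := hfin I
  -- Terms whose `I`-coefficient vanishes identically have derivatives with vanishing
  -- `I`-coefficient, so `S I` is a sum over the same finite set.
  have h1 : ∀ i ∉ s, f' i I = 0 := fun i hi => by
    have h2 := hasGDiff_iff_apply.1 (hf i) I
    have h3 : (fun z => f i z I) = fun _ => (0 : FG) I := funext fun z => hs i hi z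
    rw [h3] at h2
    exact h2.unique (hasGDiff_iff_apply.1 (hasGDiff_const 0 x y) I)
  rw [FG.hasSum_apply hS h1]
  have h2 := hasGDiff_iff_apply.1 (HasGDiff.sum (s := s) fun i _ => hf i) I
  simp only [FG.sum_apply] at h2
  refine h2.congr fun t => ?_
  simp only [FG.hasSum_apply (hF _) fun i hi => hs i hi _]

theorem hasGDiff_of_affine {g : E → FG} {x y : E} {v : FG}
    (h : ∀ t : ℝ, g (x + t • y) = g x + t • v) : HasGDiff g x y v := by
  refine Tendsto.congr' ?_ tendsto_const_nhds
  filter_upwards [self_mem_nhdsWithin] with t ht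
  rw [h, add_sub_cancel_left, smul_smul, inv_mul_cancel₀ ht, one_smul]

/-- In `ℭ` the power rule needs the derivative to commute with `g x`; evenness of `v` provides this.
For `k = 0` the factor `k` hides the truncated exponent. -/
theorem HasGDiff.pow_of_isEven {g : E → FG} {x y : E} {v : FG} (h : HasGDiff g x y v)
    (hv : FG.IsEven v) (k : ℕ) :
    HasGDiff (fun z => g z ^ k) x y ((k : ℝ) • (v * g x ^ (k - 1))) := by
  induction k with
  | zero => simpa using hasGDiff_const 1 x y
  | succ k ih =>
    simp only [pow_succ]
    convert ih.mul h using 1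
    rw [← hv.commute (g x ^ k), Nat.add_sub_cancel, Nat.cast_succ, add_smul, one_smul]
    congr 1
    cases k with
    | zero => simp
    | succ k => rw [Nat.add_sub_cancel, smul_mul_assoc, mul_assoc, ← pow_succ]

end

/-! ### The Grassmann continuation is superdifferentiable -/

section

variable {m n : ℕ}

theorem HasGDiff.of_eq {E Y : Type*} [AddCommGroup E] [Module ℝ E] [AddCommGroup Y] [Module ℝ Y]
    [TopologicalSpace Y] {f : E → Y} {x y : E} {v w : Y} (h : HasGDiff f x y v) (e : v = w) :
    HasGDiff f x y w := e ▸ h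

theorem soul_isEven (x : Rev) : FG.IsEven (soul x) := by
  intro I hI
  rw [soul, FG.sub_apply, x.2.1 I hI, FG.mono_apply, if_neg, sub_zero]
  rintro rfl
  simp at hI

theorem coe_eq_body_add_soul (x : Rev) : (x : FG) = ((x : FG) ∅).re • (1 : FG) + soul x := by
  have : FG.mono ∅ ((x : FG) ∅) = ((x : FG) ∅).re • (1 : FG) := by
    conv_lhs => rw [← Complex.re_add_im ((x : FG) ∅), x.2.2]
    ext J
    simp [FG.mono_apply, FG.one_apply]
  rw [soul, this]
  abel

theorem soul_add_smul (x h : Rev) (t : ℝ) : soul (x + t • h) = soul x + t • soul h := by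
  ext I
  simp only [soul, FG.sub_apply, FG.add_apply, FG.real_smul_apply, FG.mono_apply,
    Subalgebra.coe_add, Rev.coe_real_smul]
  split_ifs <;> ring

theorem hasGDiff_soul (j : Fin m) (X H : SuperSpace m n) :
    HasGDiff (fun Z : SuperSpace m n => soul (Z.1 j)) X H (soul (H.1 j)) :=
  hasGDiff_of_affine fun t => soul_add_smul (X.1 j) (H.1 j) t

theorem continuous_soul (j : Fin m) : Continuous fun X : SuperSpace m n => soul (X.1 j) :=
  (continuous_even j).sub
    ((continuous_mono ∅).comp ((FG.continuous_apply ∅).comp (continuous_even j)))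

/-- The product of powers of souls along a list of coordinates. -/
noncomputable def listPow (l : List (Fin m)) (α : Fin m → ℕ) (X : SuperSpace m n) : FG :=
  (l.map fun j => soul (X.1 j) ^ α j).prod

theorem listPow_cons (i : Fin m) (l : List (Fin m)) (α : Fin m → ℕ) (X : SuperSpace m n) :
    listPow (i :: l) α X = soul (X.1 i) ^ α i * listPow l α X := by
  simp [listPow]

theorem listPow_congr {l : List (Fin m)} {α β : Fin m → ℕ} (h : ∀ i ∈ l, α i = β i)
    (X : SuperSpace m n) : listPow l α X = listPow l β X := by
  unfold listPow
  congr 1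
  exact List.map_congr_left fun i hi => by rw [h i hi]

theorem continuous_listPow (l : List (Fin m)) (α : Fin m → ℕ) :
    Continuous (listPow (n := n) l α) := by
  induction l with
  | nil => exact continuous_const
  | cons i l ih =>
    simp only [funext (listPow_cons i l α)]
    exact ((continuous_soul i).pow _).mul ih

theorem hasGDiff_listPow {l : List (Fin m)} (hl : l.Nodup) (α : Fin m → ℕ)
    (X H : SuperSpace m n) : HasGDiff (listPow l α) X H
      (l.map fun j => (α j : ℝ) • (soul (H.1 j) *
        listPow l (Function.update α j (α j - 1)) X)).sum := by
  induction l with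
  | nil => exact hasGDiff_const 1 X H
  | cons i l ih =>
    obtain ⟨hi, hl⟩ := List.nodup_cons.1 hl
    simp only [funext (listPow_cons i l α)]
    convert ((hasGDiff_soul i X H).pow_of_isEven (soul_isEven _) (α i)).mul (ih hl) using 1
    rw [List.map_cons, List.sum_cons]
    congr 1
    · rw [listPow_cons, Function.update_self, smul_mul_assoc, mul_assoc]
      congr 3
      refine listPow_congr (fun k hk => ?_) X
      exact Function.update_of_ne (by rintro rfl; exact hi hk) _ _
    · rw [← List.sum_map_mul_left]
      congr 1
      refine List.map_congr_left fun j hj => ?_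
      have hij : i ≠ j := by rintro rfl; exact hi hj
      rw [listPow_cons, Function.update_of_ne hij, mul_smul_comm,
        (soul_isEven _).mul_left_comm]

theorem hasGDiff_soulPow (α : Fin m → ℕ) (X H : SuperSpace m n) :
    HasGDiff (fun Z : SuperSpace m n => soulPow Z.1 α) X H
      (∑ j, (α j : ℝ) • (soul (H.1 j) * soulPow X.1 (Function.update α j (α j - 1)))) := by
  have := hasGDiff_listPow (List.nodup_finRange m) α X H
  rw [← List.ofFn_eq_map, List.sum_ofFn] at this
  exact this

theorem continuous_body : Continuous (body : SuperSpace m n → Fin m → ℝ) :=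
  continuous_pi fun j =>
    Complex.continuous_re.comp ((FG.continuous_apply ∅).comp (continuous_even j))

theorem body_add_smul (X H : SuperSpace m n) (t : ℝ) :
    body (X + t • H) = body X + t • body H := by
  ext j
  simp [body]

variable {V : Set (Fin m → ℝ)} {u : (Fin m → ℝ) → FG}

theorem hasGDiff_multiDFG (hV : IsOpen V) (hu : SmoothOnFG u V) (α : Fin m → ℕ)
    {X : SuperSpace m n} (hX : body X ∈ V) (H : SuperSpace m n) :
    HasGDiff (fun Z : SuperSpace m n => multiDFG α u (body Z)) X H
      (∑ j, body H j • multiDFG α (partialFG j u) (body X)) := by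
  refine hasGDiff_iff_apply.2 fun J => hasGDiff_iff_hasDerivAt.2 ?_
  have h1 := ((listD_contDiffOn hV (hu J) (List.finRange m) α).differentiableAt_of_isOpen
    hV hX).hasFDerivAt
  have h2 : HasDerivAt (fun t : ℝ => body X + t • body H) (body H) 0 := by
    simpa using ((hasDerivAt_id (0 : ℝ)).smul_const (body H)).const_add (body X)
  have h3 : HasDerivAt (fun t : ℝ => body (X + t • H)) (body H) 0 := by
    simpa only [body_add_smul] using h2
  have h4 : body (X + (0 : ℝ) • H) = body X := by simp
  rw [← h4] at h1
  refine (h1.comp_hasDerivAt (0 : ℝ) h3).congr_deriv ?_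
  rw [h4]
  conv_lhs => rw [pi_eq_sum_univ' (body H)]
  rw [map_sum, FG.sum_apply]
  refine Finset.sum_congr rfl fun j _ => ?_
  rw [map_smul, FG.real_smul_apply, Complex.real_smul]
  congr 1
  refine Eq.trans ?_ (listD_partialD hV (hu J) (List.finRange m) α j hX).symm
  rfl

theorem contTerm_eq_zero (u : (Fin m → ℝ) → FG) (I : Finset ℕ) : ∃ s : Finset (Fin m → ℕ),
    ∀ α ∉ s, ∀ x, contTerm u x α I = 0 := by
  refine ⟨(Set.finite_Iic (fun _ : Fin m => I.card)).toFinset, fun α hα x => ?_⟩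
  simp only [Set.Finite.mem_toFinset, Set.mem_Iic, Pi.le_def, not_forall, not_le] at hα
  obtain ⟨j, hj⟩ := hα
  have h : I.card < ∑ j, α j :=
    lt_of_lt_of_le hj (Finset.single_le_sum (f := α) (fun _ _ => Nat.zero_le _)
      (Finset.mem_univ j))
  have := FG.mul_of_mul_order (X := multiDFG α u (fun j => ((x j : FG) ∅).re))
    (soulPow_order x α) I h
  simp [contTerm, this]

/-- The part of the differential of `contTerm u x α` that comes from the `j`-th soul. -/
noncomputable def contShift (u : (Fin m → ℝ) → FG) (X : SuperSpace m n) (j : Fin m)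
    (α : Fin m → ℕ) : FG :=
  (∏ i, (α i)! : ℝ)⁻¹ • ((α j : ℝ) •
    (multiDFG α u (body X) * soulPow X.1 (Function.update α j (α j - 1))))

/-- The factor `α_j + 1` produced by the power rule cancels against `(α + e_j)!`, and the extra
derivative in `∂^(α + e_j) u` is absorbed into `∂_j u`. -/
theorem contShift_update (hV : IsOpen V) (hu : SmoothOnFG u V) {X : SuperSpace m n}
    (hX : body X ∈ V) (j : Fin m) (α : Fin m → ℕ) :
    contShift u X j (Function.update α j (α j + 1)) = contTerm (partialFG j u) X.1 α := by
  have hf : (∏ i, ((Function.update α j (α j + 1) i)! : ℝ)) =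
      ((α j + 1 : ℕ) : ℝ) * ∏ i, ((α i)! : ℝ) := by
    rw [← Finset.mul_prod_erase _ _ (Finset.mem_univ j),
      ← Finset.mul_prod_erase Finset.univ (fun i => ((α i)! : ℝ)) (Finset.mem_univ j),
      Function.update_self, Nat.factorial_succ, Nat.cast_mul, mul_assoc]
    congr 2
    refine Finset.prod_congr rfl fun i hi => ?_
    rw [Function.update_of_ne (Finset.ne_of_mem_erase hi)]
  have hne : ((α j + 1 : ℕ) : ℝ) ≠ 0 := by positivity
  unfold contShift contTerm
  rw [multiDFG_update hV hu α j hX, hf, Function.update_self, Nat.add_sub_cancel,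
    Function.update_idem, Function.update_eq_self, smul_smul, mul_inv, mul_comm, ← mul_assoc,
    mul_inv_cancel₀ hne, one_mul]
  rfl

theorem hasSum_contShift (hV : IsOpen V) (hu : SmoothOnFG u V) {X : SuperSpace m n}
    (hX : body X ∈ V) (j : Fin m) :
    HasSum (contShift u X j) (grassmannCont (partialFG j u) X.1) := by
  have hinj : Function.Injective fun α : Fin m → ℕ => Function.update α j (α j + 1) := by
    intro α β h
    funext i
    have hi := congrFun h i
    rcases eq_or_ne i j with rfl | hij
    · simpa using hi
    · simpa [hij] using hi
  -- Reindex by `α ↦ α + e_j`. The indices missed have `α_j = 0`, and their terms vanish through the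
  -- factor `α_j`.
  refine (hinj.hasSum_iff fun α hα => ?_).1 ?_
  · have : α j = 0 := by
      by_contra h0
      refine hα ⟨Function.update α j (α j - 1), ?_⟩
      simp only [Function.update_self, Function.update_idem]
      rw [Nat.sub_add_cancel (Nat.pos_of_ne_zero h0), Function.update_eq_self]
    simp [contShift, this]
  · simp only [Function.comp_def, contShift_update hV hu hX]
    exact hasSum_grassmannCont _ _

theorem hasGDiff_contTerm (hV : IsOpen V) (hu : SmoothOnFG u V) (α : Fin m → ℕ)
    {X : SuperSpace m n} (hX : body X ∈ V) (H : SuperSpace m n) :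
    HasGDiff (fun Z : SuperSpace m n => contTerm u Z.1 α) X H
      (∑ j, (body H j • contTerm (partialFG j u) X.1 α + soul (H.1 j) * contShift u X j α)) := by
  have h := ((hasGDiff_multiDFG hV hu α hX H).mul (hasGDiff_soulPow α X H)).const_smul
    (∏ j, (α j)! : ℝ)⁻¹
  refine h.of_eq ?_
  rw [smul_add, Finset.sum_add_distrib, Finset.sum_mul, Finset.smul_sum, Finset.mul_sum,
    Finset.smul_sum]
  congr 1
  · refine Finset.sum_congr rfl fun j _ => ?_
    rw [smul_mul_assoc, smul_comm]
    rfl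
  · refine Finset.sum_congr rfl fun j _ => ?_
    rw [contShift, mul_smul_comm, mul_smul_comm, mul_smul_comm, (soul_isEven _).mul_left_comm]

/-- Differentiating `∂^α u` contributes the body of `H_j` times the continuation of `∂_j u`.
Differentiating the soul powers contributes the soul of `H_j` times the same continuation, with its
index shifted. Together they give `H_j`. -/
theorem hasGDiff_grassmannCont (hV : IsOpen V) (hu : SmoothOnFG u V)
    {X : SuperSpace m n} (hX : body X ∈ V) (H : SuperSpace m n) :
    HasGDiff (fun Z : SuperSpace m n => grassmannCont u Z.1) X H
      (superLin (fun j => grassmannCont (partialFG j u) X.1) (fun _ => 0) H) := by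
  refine hasGDiff_of_hasSum (f := fun α (Z : SuperSpace m n) => contTerm u Z.1 α)
    (fun Z => hasSum_grassmannCont u Z.1) (fun I => ?_)
    (fun α => hasGDiff_contTerm hV hu α hX H) ?_
  · obtain ⟨s, hs⟩ := contTerm_eq_zero u I
    exact ⟨s, fun α hα Z => hs α hα Z.1⟩
  · simp only [superLin_apply, mul_zero, Finset.sum_const_zero, add_zero]
    refine hasSum_sum fun j _ => ?_
    have h1 := (hasSum_grassmannCont (partialFG j u) X.1).const_smul (body H j)
    have h2 := (hasSum_contShift hV hu hX j).mul_left (soul (H.1 j))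
    convert h1.add h2 using 1
    conv_lhs => rw [coe_eq_body_add_soul, add_mul, smul_mul_assoc, one_mul]
    rfl

theorem continuousOn_grassmannCont (hV : IsOpen V) (hu : SmoothOnFG u V)
    {U : Set (SuperSpace m n)} (hU : MapsTo body U V) :
    ContinuousOn (fun Z : SuperSpace m n => grassmannCont u Z.1) U := by
  refine continuousOn_of_hasSum (f := fun α (Z : SuperSpace m n) => contTerm u Z.1 α)
    (fun Z => hasSum_grassmannCont u Z.1) (fun I => ?_) (fun α => ?_)
  · obtain ⟨s, hs⟩ := contTerm_eq_zero u I
    exact ⟨s, fun α hα Z => hs α hα Z.1⟩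
  · refine ContinuousOn.const_smul (ContinuousOn.mul ?_
      (continuous_listPow (List.finRange m) α).continuousOn) _
    refine FG.continuousOn_iff.2 fun J => ?_
    exact (listD_contDiffOn hV (hu J) (List.finRange m) α).continuousOn.comp
      continuous_body.continuousOn hU

theorem isGSD_zero {U : Set (SuperSpace m n)} (r : ℕ) :
    IsGSD r (fun _ : SuperSpace m n => (0 : FG)) U := by
  induction r with
  | zero => exact continuousOn_const
  | succ r ih =>
    refine ⟨fun _ _ => 0, fun _ _ => 0, fun _ => continuousOn_const, fun _ => continuousOn_const,
      fun X _ H => ?_, fun _ => ih, fun _ => ih⟩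
    simpa using hasGDiff_const 0 X H

theorem isGSD_grassmannCont (hV : IsOpen V) {U : Set (SuperSpace m n)} (hU : MapsTo body U V)
    (r : ℕ) : ∀ u : (Fin m → ℝ) → FG, SmoothOnFG u V →
      IsGSD r (fun Z : SuperSpace m n => grassmannCont u Z.1) U := by
  induction r with
  | zero => exact fun u hu => continuousOn_grassmannCont hV hu hU
  | succ r ih =>
    intro u hu
    refine ⟨fun j Z => grassmannCont (partialFG j u) Z.1, fun _ _ => 0, fun j => ?_,
      fun _ => continuousOn_const, fun X hX H => hasGDiff_grassmannCont hV hu (hU hX) H,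
      fun j => ih _ (hu.partialFG hV j), fun _ => isGSD_zero r⟩
    exact continuousOn_grassmannCont hV (hu.partialFG hV j) hU

/-! ### Stability of superdifferentiability under sums and odd factors -/

variable {U : Set (SuperSpace m n)} {f g : SuperSpace m n → FG}

theorem superLin_add (F F' : Fin m → FG) (G G' : Fin n → FG) (H : SuperSpace m n) :
    superLin (fun j => F j + F' j) (fun k => G k + G' k) H = superLin F G H + superLin F' G' H := by
  simp only [superLin_apply, mul_add, Finset.sum_add_distrib]
  abel

theorem superLin_sub (F F' : Fin m → FG) (G G' : Fin n → FG) (H : SuperSpace m n) :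
    superLin (fun j => F j - F' j) (fun k => G k - G' k) H = superLin F G H - superLin F' G' H := by
  simp only [superLin_apply, mul_sub, Finset.sum_sub_distrib]
  abel

theorem IsGSD.add {r : ℕ} : ∀ {f g : SuperSpace m n → FG}, IsGSD r f U → IsGSD r g U →
    IsGSD r (fun X => f X + g X) U := by
  induction r with
  | zero => exact fun hf hg => ContinuousOn.add hf hg
  | succ r ih =>
    rintro f g ⟨F, G, hF, hG, h, hF', hG'⟩ ⟨A, B, hA, hB, h', hA', hB'⟩
    refine ⟨fun j X => F j X + A j X, fun k X => G k X + B k X, fun j => (hF j).add (hA j),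
      fun k => (hG k).add (hB k), fun X hX H => ?_, fun j => ih (hF' j) (hA' j),
      fun k => ih (hG' k) (hB' k)⟩
    have := (h X hX H).add (h' X hX H)
    exact HasGDiff.of_eq this (superLin_add _ _ _ _ H).symm

theorem IsGSD.sub {r : ℕ} : ∀ {f g : SuperSpace m n → FG}, IsGSD r f U → IsGSD r g U →
    IsGSD r (fun X => f X - g X) U := by
  induction r with
  | zero => exact fun hf hg => ContinuousOn.sub hf hg
  | succ r ih =>
    rintro f g ⟨F, G, hF, hG, h, hF', hG'⟩ ⟨A, B, hA, hB, h', hA', hB'⟩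
    refine ⟨fun j X => F j X - A j X, fun k X => G k X - B k X, fun j => (hF j).sub (hA j),
      fun k => (hG k).sub (hB k), fun X hX H => ?_, fun j => ih (hF' j) (hA' j),
      fun k => ih (hG' k) (hB' k)⟩
    have := (h X hX H).sub (h' X hX H)
    exact HasGDiff.of_eq this (superLin_sub _ _ _ _ H).symm

/-- This is the product rule with the direction moved to the left: even `H_j` pass `θ_k` freely, odd
`H_l` change the sign. -/
theorem HasSD.odd_mul {F : Fin m → SuperSpace m n → FG} {G : Fin n → SuperSpace m n → FG}
    (h : HasSD f U F G) (k : Fin n) : HasSD (fun X => (X.2 k : FG) * f X) U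
      (fun j X => (X.2 k : FG) * F j X)
      (fun l X => (if l = k then f X else 0) - (X.2 k : FG) * G l X) := by
  intro X hX H
  have h1 : HasGDiff (fun X : SuperSpace m n => (X.2 k : FG)) X H (H.2 k : FG) :=
    hasGDiff_of_affine fun t => rfl
  convert h1.mul (h X hX H) using 1
  simp only [superLin_apply, mul_add, mul_sub, Finset.mul_sum, Finset.sum_sub_distrib, mul_ite,
    mul_zero, Finset.sum_ite_eq', Finset.mem_univ, if_true]
  have e1 : ∀ j, (H.1 j : FG) * ((X.2 k : FG) * F j X) = (X.2 k : FG) * ((H.1 j : FG) * F j X) :=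
    fun j => (isEven_coe _).mul_left_comm _ _
  have e2 : ∀ l, (H.2 l : FG) * ((X.2 k : FG) * G l X) =
      -((X.2 k : FG) * ((H.2 l : FG) * G l X)) :=
    fun l => (isOdd_coe _).mul_left_comm (isOdd_coe _) _
  simp only [e1, e2, Finset.sum_neg_distrib]
  abel

theorem IsGSD.odd_mul (hU : IsOpen U) (k : Fin n) {r : ℕ} : ∀ {f : SuperSpace m n → FG},
    IsGSD r f U → IsGSD r (fun X => (X.2 k : FG) * f X) U := by
  induction r with
  | zero => exact fun hf => (continuous_odd k).continuousOn.mul hf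
  | succ r ih =>
    intro f hf
    -- The `k`-th odd coefficient of `θ_k f` contains `f` itself, so `f` is also needed at level
    -- `r`.
    have hf' := hf.of_succ hU
    obtain ⟨F, G, hF, hG, h, hF', hG'⟩ := hf
    have hite : ∀ l, IsGSD r (fun X => if l = k then f X else 0) U := fun l => by
      split_ifs
      · exact hf'
      · exact isGSD_zero r
    have hG2 : ∀ l, IsGSD r (fun X => (if l = k then f X else 0) - (X.2 k : FG) * G l X) U :=
      fun l => (hite l).sub (ih (hG' l))
    exact ⟨_, _, fun j => (ih (hF' j)).continuousOn hU, fun l => (hG2 l).continuousOn hU,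
      HasSD.odd_mul h k, fun j => ih (hF' j), hG2⟩

theorem IsGSD.oddPow_mul (hU : IsOpen U) {r : ℕ} (a : Fin n → Fin 2) (hf : IsGSD r f U) :
    IsGSD r (fun X => oddPow X.2 a * f X) U := by
  have hpow : ∀ (k : Fin n) (i : ℕ) (g : SuperSpace m n → FG), IsGSD r g U →
      IsGSD r (fun X => (X.2 k : FG) ^ i * g X) U := by
    intro k i
    induction i with
    | zero => exact fun g hg => by simpa using hg
    | succ i ih =>
      intro g hg
      simp only [pow_succ', mul_assoc]
      exact IsGSD.odd_mul hU k (ih g hg)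
  have : ∀ l : List (Fin n), IsGSD r
      (fun X => (l.map fun k => (X.2 k : FG) ^ (a k : ℕ)).prod * f X) U := by
    intro l
    induction l with
    | nil => simpa using hf
    | cons k l ih =>
      simp only [List.map_cons, List.prod_cons, mul_assoc]
      exact hpow k _ _ ih
  exact this _

theorem IsGSD.sum {ι : Type*} {s : Finset ι} {r : ℕ} {f : ι → SuperSpace m n → FG}
    (hf : ∀ i ∈ s, IsGSD r (f i) U) : IsGSD r (fun X => ∑ i ∈ s, f i X) U := by
  classical
  induction s using Finset.induction_on with
  | empty => simpa using isGSD_zero r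
  | insert i s hi ih =>
    simp only [Finset.sum_insert hi]
    exact (hf i (Finset.mem_insert_self i s)).add
      (ih fun j hj => hf j (Finset.mem_insert_of_mem hj))

theorem IsGSD.congr (hU : IsOpen U) {r : ℕ} (hf : IsGSD r f U) (h : EqOn f g U) :
    IsGSD r g U := by
  cases r with
  | zero => exact ContinuousOn.congr hf h.symm
  | succ r =>
    obtain ⟨F, G, hF, hG, hFG, hF', hG'⟩ := hf
    exact ⟨F, G, hF, hG, fun X hX H => (hFG X hX H).congr_of_eqOn hU hX h, hF', hG'⟩

end

/-- The inclusion of the real points. -/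
noncomputable def realVec {m : ℕ} (n : ℕ) : (Fin m → ℝ) →ₗ[ℝ] SuperSpace m n where
  toFun q := (fun j => q j • 1, 0)
  map_add' p q := by
    refine Prod.ext (funext fun j => ?_) (by simp)
    simp [add_smul]
  map_smul' c q := by
    refine Prod.ext (funext fun j => ?_) (by simp)
    simp [mul_smul]

theorem continuous_realVec {m n : ℕ} : Continuous (realVec n : (Fin m → ℝ) → SuperSpace m n) :=
  (continuous_pi fun j => (continuous_apply j).smul continuous_const).prodMk continuous_const

theorem body_add_realVec {m n : ℕ} (X : SuperSpace m n) (q : Fin m → ℝ) :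
    body (X + realVec n q) = body X + q := by
  ext j
  have : ((X + realVec n q).1 j : FG) = (X.1 j : FG) + q j • (1 : FG) := rfl
  simp only [body, Pi.add_apply]
  rw [this]
  simp [FG.one_apply]

theorem isOpen_image_body {m n : ℕ} {U : Set (SuperSpace m n)} (hU : IsOpen U) :
    IsOpen (body '' U) := by
  refine isOpen_iff_mem_nhds.2 ?_
  rintro _ ⟨X, hX, rfl⟩
  -- Translating `X` by real vectors stays in `U` for a short while and covers a neighbourhood of
  -- the body of `X`.
  have hc : Continuous fun q : Fin m → ℝ => X + realVec n (q - body X) :=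
    continuous_const.add (continuous_realVec.comp (continuous_id.sub continuous_const))
  have h0 : X + realVec n (body X - body X) ∈ U := by simpa using hX
  filter_upwards [hc.continuousAt.preimage_mem_nhds (hU.mem_nhds h0)] with q hq
  exact ⟨_, hq, by rw [body_add_realVec, add_sub_cancel]⟩

theorem IsSupersmooth.isGSDInfty {m n : ℕ} {U : Set (SuperSpace m n)} (hU : IsOpen U)
    {f : SuperSpace m n → FG} (h : IsSupersmooth f U) : IsGSDInfty f U := by
  obtain ⟨u, hu, hf⟩ := h
  intro r _
  have : IsGSD r (fun X : SuperSpace m n => ∑ a, oddPow X.2 a * grassmannCont (u a) X.1) U :=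
    IsGSD.sum fun a _ => IsGSD.oddPow_mul hU a
      (isGSD_grassmannCont (isOpen_image_body hU) (mapsTo_image body U) r (u a) (hu a))
  exact this.congr hU fun X hX => (hf X hX).symm

/-! ### Splitting off the odd coordinates -/

section

variable {m n : ℕ} {U : Set (SuperSpace m n)} {f : SuperSpace m n → FG}

theorem IsGSDInfty.sub {g : SuperSpace m n → FG} (hf : IsGSDInfty f U) (hg : IsGSDInfty g U) :
    IsGSDInfty (fun X => f X - g X) U := fun r hr => (hf r hr).sub (hg r hr)

theorem IsGSDInfty.exists_hasSD (hU : IsOpen U) (hf : IsGSDInfty f U) :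
    ∃ F G, HasSD f U F G ∧ (∀ j, IsGSDInfty (F j) U) ∧ ∀ k, IsGSDInfty (G k) U := by
  obtain ⟨hc, F, G, -, -, h, -⟩ := (isGSDInfty_iff_isGSD_one hU f).1 hf
  have h' : HasSD f U F G := h
  have hl := h'.hasRevLinearGDiff hU hc
  refine ⟨F, G, h, fun j => (isGSDInfty_iff_isGSD_one hU _).2 ⟨h'.isCGInfty_even hU hc j, ?_⟩,
    fun k => (isGSDInfty_iff_isGSD_one hU _).2 ⟨h'.isCGInfty_odd hU hc k, ?_⟩⟩
  · exact isGSD_one_of_hasRevLinearGDiff hU (h'.isCGInfty_even hU hc j 1) (hl.1 j)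
  · exact isGSD_one_of_hasRevLinearGDiff hU (h'.isCGInfty_odd hU hc k 1) (hl.2 k)

/-- The differential of `f` vanishes in the `k`-th odd direction. -/
def OddConst (f : SuperSpace m n → FG) (U : Set (SuperSpace m n)) (k : Fin n) : Prop :=
  ∀ X ∈ U, ∀ θ, HasGDiff f X (oddVec m k θ) 0

theorem HasSD.oddConst_iff {F : Fin m → SuperSpace m n → FG} {G : Fin n → SuperSpace m n → FG}
    (h : HasSD f U F G) (k : Fin n) : OddConst f U k ↔ ∀ X ∈ U, G k X = 0 := by
  refine ⟨fun h0 X hX => FG.eq_of_rod_mul_eq fun θ => ?_, fun h0 X hX θ => ?_⟩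
  · rw [mul_zero]
    exact (h.oddVec k θ hX).unique (h0 X hX θ)
  · have := h.oddVec k θ hX
    rwa [h0 X hX, mul_zero] at this

/-- Odd partial derivatives anticommute. -/
theorem HasSD.odd_anticomm (hU : IsOpen U) (hf : IsCGInfty f U)
    {F : Fin m → SuperSpace m n → FG} {G : Fin n → SuperSpace m n → FG} (h : HasSD f U F G)
    {k l : Fin n} {X : SuperSpace m n} (hX : X ∈ U) {Gkl Glk : FG}
    (hk : ∀ η : Rod, HasGDiff (G k) X (_root_.oddVec m l η) (η * Gkl))
    (hl : ∀ η : Rod, HasGDiff (G l) X (_root_.oddVec m k η) (η * Glk)) : Gkl = -Glk := by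
  -- Symmetry of the second differential gives `θ η Gkl = η θ Glk`; interchanging the odd factors
  -- produces the sign.
  refine FG.eq_of_rod_mul_eq fun η => FG.eq_of_rod_mul_eq fun θ => ?_
  rw [mul_neg, mul_neg, ← (isOdd_coe η).mul_left_comm (isOdd_coe θ)]
  exact (hf 2).hasGDiff_symm hU hX (fun Z hZ => h.oddVec k θ hZ) (fun Z hZ => h.oddVec l η hZ)
    ((hk η).const_mul θ) ((hl θ).const_mul η)

/-- Take `f1 = ∂f/∂θ_k` and `f0 = f - θ_k f1`. Anticommutativity makes the second derivative in
`θ_k` vanish, so neither part varies with `θ_k`. It also preserves constancy in the other odd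
directions, which lets the splitting be repeated. -/
theorem exists_odd_split (hU : IsOpen U) (hf : IsGSDInfty f U) (k : Fin n) :
    ∃ f0 f1 : SuperSpace m n → FG, IsGSDInfty f0 U ∧ IsGSDInfty f1 U ∧
      (∀ X, f X = f0 X + (X.2 k : FG) * f1 X) ∧ ∀ l, (OddConst f U l ∨ l = k) →
        OddConst f0 U l ∧ OddConst f1 U l := by
  have hc := ((isGSDInfty_iff_isGSD_one hU f).1 hf).1
  obtain ⟨F, G, h, hF, hG⟩ := hf.exists_hasSD hU
  choose A B hAB _ _ using fun l => (hG l).exists_hasSD hU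
  have hanti : ∀ l, ∀ X ∈ U, B k l X = -B l k X := fun l X hX =>
    h.odd_anticomm hU hc hX (fun η => (hAB k).oddVec l η hX) (fun η => (hAB l).oddVec k η hX)
  have hB : ∀ l, (OddConst f U l ∨ l = k) → ∀ X ∈ U, B k l X = 0 := by
    rintro l (hl | rfl) X hX
    · have h0 := (h.oddConst_iff l).1 hl
      have h1 : OddConst (G l) U k := fun Z hZ θ =>
        (hasGDiff_const 0 Z _).congr_of_eqOn hU hZ fun Y hY => (h0 Y hY).symm
      rw [hanti l X hX, ((hAB l).oddConst_iff k).1 h1 X hX, neg_zero]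
    · exact FG.eq_zero_of_eq_neg (hanti l X hX)
  have hm : HasSD (fun X => f X - (X.2 k : FG) * G k X) U
      (fun j X => F j X - (X.2 k : FG) * A k j X)
      (fun l X => G l X - ((if l = k then G k X else 0) - (X.2 k : FG) * B k l X)) :=
    fun X hX H => ((h X hX H).sub ((hAB k).odd_mul k X hX H)).of_eq (superLin_sub _ _ _ _ H).symm
  refine ⟨fun X => f X - (X.2 k : FG) * G k X, G k,
    hf.sub fun r hr => IsGSD.odd_mul hU k (hG k r hr), hG k, fun X => (sub_add_cancel _ _).symm,
    fun l hl => ⟨(hm.oddConst_iff l).2 fun X hX => ?_, ((hAB k).oddConst_iff l).2 (hB l hl)⟩⟩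
  rw [hB l hl X hX, mul_zero, sub_zero]
  split_ifs with e
  · rw [e, sub_self]
  · rw [(h.oddConst_iff l).1 (hl.resolve_right e) X hX, sub_zero]

end

/-! ### Functions of the even coordinates -/

section

variable {m n : ℕ} {U : Set (SuperSpace m n)} {w : SuperSpace m n → FG}

theorem superLin_realVec (F : Fin m → FG) (G : Fin n → FG) (q : Fin m → ℝ) :
    superLin F G (realVec n q) = ∑ j, q j • F j := by
  rw [superLin_apply]
  have h1 : ∀ k, ((realVec n q).2 k : FG) = 0 := fun _ => rfl
  have h2 : ∀ j, ((realVec n q).1 j : FG) = q j • (1 : FG) := fun _ => rfl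
  simp only [h1, h2, zero_mul, Finset.sum_const_zero, add_zero, smul_mul_assoc, one_mul]

/-- Superdifferentiable functions are smooth along the real directions. -/
theorem IsGSDInfty.contDiffOn_realVec (hU : IsOpen U) (X : SuperSpace m n) (I : Finset ℕ) (k : ℕ) :
    ∀ w : SuperSpace m n → FG, IsGSDInfty w U →
      ContDiffOn ℝ k (fun q => w (X + realVec n q) I) ((fun q => X + realVec n q) ⁻¹' U) := by
  have hc : Continuous fun q => X + realVec n q := continuous_const.add continuous_realVec
  induction k with
  | zero =>
    intro w hw
    refine contDiffOn_zero.2 ((FG.continuousOn_iff.1 ((hw 1 le_rfl).continuousOn hU) I).comp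
      hc.continuousOn fun q hq => hq)
  | succ k ih =>
    intro w hw
    obtain ⟨F, G, h, hF, -⟩ := hw.exists_hasSD hU
    have hO : IsOpen ((fun q => X + realVec n q) ⁻¹' U) := hU.preimage hc
    have hL : ContDiffOn ℝ k (fun q => ∑ j, F j (X + realVec n q) I •
        Complex.ofRealCLM.comp (ContinuousLinearMap.proj j : (Fin m → ℝ) →L[ℝ] ℝ))
        ((fun q => X + realVec n q) ⁻¹' U) :=
      ContDiffOn.sum fun j _ => (ih (F j) (hF j)).smul contDiffOn_const
    have hd : ∀ q ∈ (fun q => X + realVec n q) ⁻¹' U,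
        HasFDerivAt (fun q => w (X + realVec n q) I) (∑ j, F j (X + realVec n q) I •
        Complex.ofRealCLM.comp (ContinuousLinearMap.proj j : (Fin m → ℝ) →L[ℝ] ℝ))
        q := by
      intro q hq
      refine hasFDerivAt_of_hasGDiff (L := fun q => ∑ j, F j (X + realVec n q) I •
        Complex.ofRealCLM.comp (ContinuousLinearMap.proj j : (Fin m → ℝ) →L[ℝ] ℝ))
        hO (fun q hq p => ?_) hL.continuousOn hq
      have h1 := hasGDiff_iff_apply.1 (h _ hq (realVec n p)) I
      rw [superLin_realVec, FG.sum_apply] at h1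
      refine HasGDiff.of_eq (v := ∑ j, (p j • F j (X + realVec n q)) I) ?_ ?_
      · refine h1.congr fun t => ?_
        simp only [map_add, map_smul, add_assoc]
      · simp [mul_comm]
    rw [Nat.cast_succ, contDiffOn_succ_iff_fderiv_of_isOpen hO]
    refine ⟨fun q hq => (hd q hq).differentiableAt.differentiableWithinAt, fun e => ?_,
      hL.congr fun q hq => (hd q hq).fderiv⟩
    exact absurd e (by simp)

/-- `w` is superdifferentiable, does not depend on the odd coordinates, and its coefficients of
degree less than `d` vanish. -/
structure IsEvenOrder (d : ℕ) (w : SuperSpace m n → FG) (U : Set (SuperSpace m n)) : Prop where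
  isGSDInfty : IsGSDInfty w U
  oddConst : ∀ k, OddConst w U k
  order : ∀ X ∈ U, ∀ I : Finset ℕ, I.card < d → w X I = 0

/-- The even derivatives of `w` also have no coefficients of degree below `d`, and a direction
without body has none of degree zero. Hence `∑_j H_j F_j` starts in degree `d + 1`; the odd
derivatives vanish by assumption. -/
theorem IsEvenOrder.hasGDiff_soul (hU : IsOpen U) {d : ℕ} (hw : IsEvenOrder d w U)
    {I : Finset ℕ} (hI : I.card = d) {X : SuperSpace m n} (hX : X ∈ U) {H : SuperSpace m n}
    (hH : body H = 0) : HasGDiff (fun Z => w Z I) X H 0 := by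
  obtain ⟨F, G, h, -, -⟩ := hw.isGSDInfty.exists_hasSD hU
  refine (hasGDiff_iff_apply.1 (h X hX H) I).of_eq ?_
  rw [superLin_apply, Finset.sum_eq_zero (s := Finset.univ)
    (f := fun k => (H.2 k : FG) * G k X), add_zero, FG.sum_apply]
  · refine Finset.sum_eq_zero fun j _ => ?_
    refine FG.mul_order (d := 1) (e := d) (fun K hK => ?_) (fun K hK => ?_) I (by omega)
    · obtain rfl : K = ∅ := Finset.card_eq_zero.1 (by omega)
      exact Complex.ext (congrFun hH j) (H.1 j).2.2
    · refine (hasGDiff_iff_apply.1 (h.evenVec j hX) K).unique ?_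
      exact (hasGDiff_iff_apply.1 (hasGDiff_const 0 X _) K).congr_of_eqOn hU hX
        fun Z hZ => (hw.order Z hZ K hK).symm
  · intro k _
    rw [(h.oddConst_iff k).1 (hw.oddConst k) X hX, mul_zero]

theorem body_sub (X Z : SuperSpace m n) : body (X - Z) = body X - body Z := by
  ext j
  simp [body]

theorem IsEvenOrder.eq_of_body_eq (hU : IsOpen U) {d : ℕ} (hw : IsEvenOrder d w U)
    (hfib : ∀ q : Fin m → ℝ, IsPreconnected {X | X ∈ U ∧ body X = q})
    {I : Finset ℕ} (hI : I.card = d) {X Z : SuperSpace m n} (hX : X ∈ U) (hZ : Z ∈ U)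
    (hXZ : body Z = body X) : w Z I = w X I := by
  have := isPreconnected_iff_preconnectedSpace.1 (hfib (body X))
  have hlc : IsLocallyConstant fun Y : {Y | Y ∈ U ∧ body Y = body X} => w Y I := by
    rw [IsLocallyConstant.iff_eventually_eq]
    rintro ⟨Y, hY, hYb⟩
    -- Two points of the same fibre differ by a direction without body, so the derivative along the
    -- short segment joining them is zero. The fibre includes the odd coordinates, so constancy in
    -- these is obtained as well.
    obtain ⟨W, hW, hWU⟩ := exists_balanced_nhds hU hY
    filter_upwards [continuousAt_subtype_val.preimage_mem_nhds hW]
    rintro ⟨Y', hY', hYb'⟩ hmem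
    have h1 : ‖w (Y + (Y' - Y)) I - w Y I‖ ≤ 0 :=
      HasGDiff.norm_sub_le (f := fun Z => w Z I) (D := fun _ => 0)
        (fun t ht => hw.hasGDiff_soul hU hI (hWU Y' hmem t ht) (by
          rw [body_sub, hYb', hYb, sub_self])) (fun t ht => by simp)
    rw [add_sub_cancel] at h1
    exact sub_eq_zero.1 (norm_le_zero_iff.1 h1)
  exact hlc.apply_eq_of_preconnectedSpace ⟨Z, hZ, hXZ⟩ ⟨X, hX, rfl⟩

end

/-! ### Algebra of the Grassmann continuation -/

section

variable {m n : ℕ} {V : Set (Fin m → ℝ)} {u v : (Fin m → ℝ) → FG}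

theorem grassmannCont_add (hV : IsOpen V) (hu : SmoothOnFG u V) (hv : SmoothOnFG v V)
    {X : SuperSpace m n} (hX : body X ∈ V) :
    grassmannCont (fun q => u q + v q) X.1 = grassmannCont u X.1 + grassmannCont v X.1 := by
  refine (hasSum_grassmannCont _ _).unique ?_
  convert (hasSum_grassmannCont u X.1).add (hasSum_grassmannCont v X.1) using 1
  funext α
  have := multiDFG_add hV hu hv α hX
  unfold contTerm
  rw [← smul_add, ← add_mul]
  exact congrArg (fun Y => _ • (Y * _)) this

theorem grassmannCont_smul (hV : IsOpen V) (hu : SmoothOnFG u V) (c : ℂ)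
    {X : SuperSpace m n} (hX : body X ∈ V) :
    grassmannCont (fun q => c • u q) X.1 = c • grassmannCont u X.1 := by
  refine (hasSum_grassmannCont _ _).unique ?_
  convert (hasSum_grassmannCont u X.1).const_smul c using 1
  funext α
  have := multiDFG_smul hV hu c α hX
  unfold contTerm
  rw [smul_comm, ← smul_mul_assoc c]
  exact congrArg (fun Y => _ • (Y * _)) this

theorem multiDFG_order {d : ℕ} (hu : ∀ q J, J.card < d → u q J = 0) (α : Fin m → ℕ)
    (q : Fin m → ℝ) (J : Finset ℕ) (hJ : J.card < d) : multiDFG α u q J = 0 := by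
  have h0 : (fun p => u p J) = fun _ => 0 := funext fun p => hu p J hJ
  have h1 : ∀ j : Fin m, partialD j (fun _ => 0) = fun _ => 0 := fun j => by
    funext q
    simp [partialD]
  have h2 : ∀ (j : Fin m) (k : ℕ), (partialD j)^[k] (fun _ => 0) = fun _ => 0 := by
    intro j k
    induction k with
    | zero => rfl
    | succ k ih => rw [Function.iterate_succ_apply', ih, h1]
  have h3 : ∀ l : List (Fin m), listD l α (fun _ => 0) = fun _ => 0 := by
    intro l
    induction l with
    | nil => rfl
    | cons i l ih => rw [listD_cons, ih, h2]
  change multiD α (fun p => u p J) q = 0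
  rw [h0, multiD_eq_listD, h3]

theorem soulPow_zero (x : Fin m → Rev) : soulPow x 0 = 1 := by
  simp [soulPow]

/-- The lowest coefficients of the Grassmann continuation. -/
theorem grassmannCont_apply_of_order {d : ℕ} (hu : ∀ q J, J.card < d → u q J = 0)
    (X : SuperSpace m n) {I : Finset ℕ} (hI : I.card ≤ d) :
    grassmannCont u X.1 I = u (body X) I := by
  rw [FG.hasSum_apply (hasSum_grassmannCont u X.1) (s := {0}) fun α hα => ?_, Finset.sum_singleton]
  · unfold contTerm
    rw [soulPow_zero, mul_one, multiDFG_zero]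
    simp
    rfl
  -- For `α ≠ 0` the soul power raises the order beyond `d`, so only the term `α = 0` reaches the
  -- coefficients of degree at most `d`.
  · have hpos : 0 < ∑ j, α j := by
      rw [Finset.mem_singleton] at hα
      obtain ⟨j, hj⟩ := Function.ne_iff.1 hα
      exact lt_of_lt_of_le (Nat.pos_of_ne_zero hj)
        (Finset.single_le_sum (f := α) (fun _ _ => Nat.zero_le _) (Finset.mem_univ j))
    have := FG.mul_order (multiDFG_order hu α fun j => ((X.1 j : FG) ∅).re)
      (soulPow_order X.1 α) I (by omega)
    simp [contTerm, this]

theorem grassmannCont_zero (x : Fin m → Rev) : grassmannCont (fun _ => 0) x = 0 := by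
  ext I
  exact grassmannCont_apply_of_order (n := 0) (u := fun _ => 0) (d := I.card) (fun _ _ _ => rfl)
    (x, 0) le_rfl

end

/-! ### Recovering a function of the even coordinates degree by degree -/

section

variable {m n : ℕ} {U : Set (SuperSpace m n)} {w f : SuperSpace m n → FG}

theorem isGSDInfty_grassmannCont (hU : IsOpen U) {u : (Fin m → ℝ) → FG}
    (hu : SmoothOnFG u (body '' U)) :
    IsGSDInfty (fun X : SuperSpace m n => grassmannCont u X.1) U := fun r _ =>
  isGSD_grassmannCont (isOpen_image_body hU) (mapsTo_image body U) r u hu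

/-- The coefficients of lowest degree `d` come from a smooth function of the body. -/
theorem IsEvenOrder.exists_sub (hU : IsOpen U) {d : ℕ} (hw : IsEvenOrder d w U)
    (hfib : ∀ q : Fin m → ℝ, IsPreconnected {X | X ∈ U ∧ body X = q}) :
    ∃ v : (Fin m → ℝ) → FG, SmoothOnFG v (body '' U) ∧ (∀ q I, I.card ≠ d → v q I = 0) ∧
      IsEvenOrder (d + 1) (fun X => w X - grassmannCont v X.1) U := by
  have hsec : ∀ q, ∃ X : SuperSpace m n, q ∈ body '' U → X ∈ U ∧ body X = q := by
    intro q
    by_cases hq : q ∈ body '' U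
    · obtain ⟨X, hX⟩ := hq
      exact ⟨X, fun _ => hX⟩
    · exact ⟨0, fun h => absurd h hq⟩
  choose s hs using hsec
  -- Any choice of points `s q` over the body works, since the degree-`d` coefficients are constant
  -- on fibres. Values outside the image of the body map are irrelevant.
  let v : (Fin m → ℝ) → FG := fun q I => if I.card = d then w (s q) I else 0
  have hv : ∀ X ∈ U, ∀ I : Finset ℕ, I.card = d → v (body X) I = w X I := by
    intro X hX I hI
    have := hs (body X) (mem_image_of_mem _ hX)
    exact (if_pos hI).trans (hw.eq_of_body_eq hU hfib hI hX this.1 this.2)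
  have hv0 : ∀ q I, I.card ≠ d → v q I = 0 := fun q I hI => if_neg hI
  have hsm : SmoothOnFG v (body '' U) := by
    intro I
    by_cases hI : I.card = d
    · rintro _ ⟨X, hX, rfl⟩
      have hc : Continuous fun q => X + realVec n q := continuous_const.add continuous_realVec
      have hO : IsOpen ((fun q => X + realVec n q) ⁻¹' U) := hU.preimage hc
      have h0 : (0 : Fin m → ℝ) ∈ (fun q => X + realVec n q) ⁻¹' U := by simpa using hX
      have h1 : ContDiffOn ℝ ∞ (fun q => w (X + realVec n q) I)
          ((fun q => X + realVec n q) ⁻¹' U) :=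
        contDiffOn_infty.2 fun k => hw.isGSDInfty.contDiffOn_realVec hU X I k w
      -- The chosen points need not depend continuously on `q`. Near `body X` the same coefficient
      -- is computed on the real translates of `X`, where `w` is smooth.
      have h2 : ContDiffAt ℝ ∞ (fun q => w (X + realVec n (q - body X)) I) (body X) := by
        have h3 : ContDiffAt ℝ ∞ (fun q => w (X + realVec n q) I) (body X - body X) := by
          rw [sub_self]
          exact h1.contDiffAt (hO.mem_nhds h0)
        exact h3.comp (body X) (f := fun q => q - body X) (contDiffAt_id.sub contDiffAt_const)
      refine (h2.congr_of_eventuallyEq ?_).contDiffWithinAt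
      have hc' : Continuous fun q : Fin m → ℝ => X + realVec n (q - body X) :=
        hc.comp (continuous_id.sub continuous_const)
      filter_upwards [hc'.continuousAt.preimage_mem_nhds (hU.mem_nhds (by simpa using hX))]
        with q hq
      have := hv _ hq I hI
      rwa [body_add_realVec, add_sub_cancel] at this
    · simp only [hv0 _ I hI]
      exact contDiffOn_const
  have hlow : ∀ q J, J.card < d → v q J = 0 := fun q J hJ => hv0 q J hJ.ne
  refine ⟨v, hsm, hv0, hw.isGSDInfty.sub (isGSDInfty_grassmannCont hU hsm), fun k X hX θ => ?_,
    fun X hX I hI => ?_⟩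
  · have h1 := hasGDiff_grassmannCont (isOpen_image_body hU) hsm (mem_image_of_mem _ hX)
      (oddVec m k θ)
    rw [superLin_oddVec, mul_zero] at h1
    exact ((hw.oddConst k X hX θ).sub h1).of_eq (sub_zero 0)
  · rw [FG.sub_apply, grassmannCont_apply_of_order hlow X (by omega)]
    rcases Nat.lt_succ_iff_lt_or_eq.1 hI with h | h
    · rw [hw.order X hX I h, hlow _ I h, sub_zero]
    · rw [hv X hX I h, sub_self]

/-- A superdifferentiable function that does not depend on the odd coordinates is a Grassmann
continuation. -/
theorem exists_eq_grassmannCont (hU : IsOpen U)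
    (hfib : ∀ q : Fin m → ℝ, IsPreconnected {X | X ∈ U ∧ body X = q})
    (hf : IsGSDInfty f U) (hodd : ∀ k, OddConst f U k) :
    ∃ u : (Fin m → ℝ) → FG, SmoothOnFG u (body '' U) ∧ ∀ X ∈ U, f X = grassmannCont u X.1 := by
  have hex : ∀ (d : ℕ) (w : SuperSpace m n → FG), IsEvenOrder d w U →
      ∃ v : (Fin m → ℝ) → FG, SmoothOnFG v (body '' U) ∧ (∀ q I, I.card ≠ d → v q I = 0) ∧
      IsEvenOrder (d + 1) (fun X => w X - grassmannCont v X.1) U :=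
    fun d w hw => hw.exists_sub hU hfib
  -- The correction is chosen as a function of both the degree and the current remainder, so that
  -- the remainders `s d` can be defined by recursion.
  choose! v hv1 hv2 hv3 using hex
  let s : ℕ → SuperSpace m n → FG := fun d =>
    Nat.rec f (fun d w X => w X - grassmannCont (v d w) X.1) d
  have hs : ∀ d, IsEvenOrder d (s d) U := by
    intro d
    induction d with
    | zero => exact ⟨hf, hodd, fun _ _ _ h => absurd h (Nat.not_lt_zero _)⟩
    | succ d ih => exact hv3 d (s d) ih
  -- The correction at stage `d` lives purely in degree `d`, so all corrections combine coefficient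
  -- by coefficient, with no question of convergence. `rest N` collects those of degree at least
  -- `N`; `rest 0` is the function sought.
  let rest : ℕ → (Fin m → ℝ) → FG := fun N q I =>
    if I.card < N then 0 else v I.card (s I.card) q I
  have hrest : ∀ N, SmoothOnFG (rest N) (body '' U) := by
    intro N I
    by_cases hI : I.card < N
    · simp only [rest, if_pos hI]
      exact contDiffOn_const
    · simp only [rest, if_neg hI]
      exact hv1 _ _ (hs _) I
  have hstep : ∀ N, rest N = fun q => v N (s N) q + rest (N + 1) q := by
    intro N
    funext q
    ext I
    rw [FG.add_apply]
    simp only [rest]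
    rcases lt_trichotomy I.card N with h | h | h
    · rw [if_pos h, if_pos (by omega), hv2 N _ (hs N) q I h.ne, add_zero]
    · rw [if_neg (by omega), if_pos (by omega), h, add_zero]
    · rw [if_neg (by omega), if_neg (by omega), hv2 N _ (hs N) q I h.ne', zero_add]
  -- Moving one degree from `rest N` into the remainder leaves the difference unchanged. With `N =
  -- |I| + 1` both terms on the right have zero `I`-coefficient.
  have hkey : ∀ N, ∀ X ∈ U,
      f X - grassmannCont (rest 0) X.1 = s N X - grassmannCont (rest N) X.1 := by
    intro N X hX
    induction N with
    | zero => rfl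
    | succ N ih =>
      rw [ih, hstep N, grassmannCont_add (isOpen_image_body hU) (hv1 N _ (hs N)) (hrest (N + 1))
        (mem_image_of_mem _ hX)]
      exact (sub_sub _ _ _).symm
  refine ⟨rest 0, hrest 0, fun X hX => sub_eq_zero.1 ?_⟩
  ext I
  have hlow : ∀ q (J : Finset ℕ), J.card < I.card + 1 → rest (I.card + 1) q J = 0 :=
    fun q J hJ => if_pos hJ
  rw [hkey (I.card + 1) X hX, FG.sub_apply, (hs _).order X hX I (Nat.lt_succ_self _),
    grassmannCont_apply_of_order hlow X (Nat.le_succ _), hlow _ I (Nat.lt_succ_self _), sub_zero]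
  rfl

end

/-! ### Closure properties of the supersmooth functions -/

/-- Moving `θ_k` to its place costs a sign, which does not depend on `θ`. If `θ_k` already occurs,
`θ_k² = 0` and the constant is `0`. -/
theorem exists_odd_mul_oddPow {n : ℕ} (k : Fin n) (a : Fin n → Fin 2) :
    ∃ c : ℂ, ∀ θ : Fin n → Rod,
      (θ k : FG) * oddPow θ a = c • oddPow θ (Function.update a k 1) := by
  have : ∀ l : List (Fin n), l.Nodup → k ∈ l → ∃ c : ℂ, ∀ θ : Fin n → Rod,
      (θ k : FG) * (l.map fun i => (θ i : FG) ^ (a i : ℕ)).prod =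
        c • (l.map fun i => (θ i : FG) ^ (Function.update a k 1 i : ℕ)).prod := by
    intro l
    induction l with
    | nil => intro _ h; simp at h
    | cons i l ih =>
      intro hl hk
      obtain ⟨hi, hl⟩ := List.nodup_cons.1 hl
      simp only [List.map_cons, List.prod_cons]
      rcases eq_or_ne k i with rfl | hki
      · have e : ∀ θ : Fin n → Rod,
            (l.map fun i => (θ i : FG) ^ (Function.update a k 1 i : ℕ)) =
              l.map fun i => (θ i : FG) ^ (a i : ℕ) := fun θ =>
          List.map_congr_left fun j hj => by
            rw [Function.update_of_ne (by rintro rfl; exact hi hj)]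
        simp only [e, Function.update_self]
        obtain h | h : a k = 0 ∨ a k = 1 := by
          generalize a k = b
          fin_cases b <;> simp
        · exact ⟨1, fun θ => by simp [h]⟩
        · refine ⟨0, fun θ => ?_⟩
          rw [h, zero_smul]
          simp only [Fin.val_one, pow_one]
          rw [← mul_assoc, (isOdd_coe (θ k)).mul_self, zero_mul]
      · obtain ⟨c, hc⟩ := ih hl ((List.mem_cons.1 hk).resolve_left hki)
        have hcomm : ∀ (θ : Fin n → Rod) (r : ℕ) (Y : FG), (θ k : FG) * ((θ i : FG) ^ r * Y) =
            ((-1 : ℂ) ^ r) • ((θ i : FG) ^ r * ((θ k : FG) * Y)) := by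
          intro θ r Y
          induction r with
          | zero => simp
          | succ r ih =>
            rw [pow_succ', mul_assoc, (isOdd_coe (θ k)).mul_left_comm (isOdd_coe (θ i)), ih,
              pow_succ, mul_neg_one, neg_smul, mul_smul_comm, mul_assoc]
        refine ⟨(-1) ^ (a i : ℕ) * c, fun θ => ?_⟩
        rw [hcomm, hc, Function.update_of_ne hki.symm, mul_smul_comm, smul_smul]
  exact this _ (List.nodup_finRange n) (List.mem_finRange k)

section

variable {m n : ℕ} {U : Set (SuperSpace m n)} {f g : SuperSpace m n → FG}

theorem IsSupersmooth.congr (h : IsSupersmooth f U) (hfg : EqOn g f U) : IsSupersmooth g U := by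
  obtain ⟨u, hu, hf⟩ := h
  exact ⟨u, hu, fun X hX => (hfg hX).trans (hf X hX)⟩

theorem IsSupersmooth.add (hU : IsOpen U) (hf : IsSupersmooth f U) (hg : IsSupersmooth g U) :
    IsSupersmooth (fun X => f X + g X) U := by
  obtain ⟨u, hu, hf⟩ := hf
  obtain ⟨v, hv, hg⟩ := hg
  refine ⟨fun a q => u a q + v a q, fun a => (hu a).add (hv a), fun X hX => ?_⟩
  simp only [hf X hX, hg X hX, ← Finset.sum_add_distrib, ← mul_add]
  refine Finset.sum_congr rfl fun a _ => ?_
  rw [grassmannCont_add (isOpen_image_body hU) (hu a) (hv a) (mem_image_of_mem _ hX)]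

theorem isSupersmooth_single {u : (Fin m → ℝ) → FG} (hu : SmoothOnFG u (body '' U))
    (a : Fin n → Fin 2) :
    IsSupersmooth (fun X : SuperSpace m n => oddPow X.2 a * grassmannCont u X.1) U := by
  classical
  refine ⟨fun b => if b = a then u else fun _ => 0, fun b => ?_, fun X _ => ?_⟩
  · simp only
    split_ifs
    · exact hu
    · exact smoothOnFG_zero
  · rw [Finset.sum_eq_single a]
    · simp
    · intro b _ hb
      simp only [if_neg hb]
      rw [grassmannCont_zero, mul_zero]
    · simp

theorem IsSupersmooth.sum (hU : IsOpen U) {ι : Type*} {s : Finset ι}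
    {f : ι → SuperSpace m n → FG} (hf : ∀ i ∈ s, IsSupersmooth (f i) U) :
    IsSupersmooth (fun X => ∑ i ∈ s, f i X) U := by
  classical
  induction s using Finset.induction_on with
  | empty =>
    exact (isSupersmooth_single smoothOnFG_zero 0).congr fun X _ => by simp [grassmannCont_zero]
  | insert i s hi ih =>
    simp only [Finset.sum_insert hi]
    exact (hf i (Finset.mem_insert_self i s)).add hU
      (ih fun j hj => hf j (Finset.mem_insert_of_mem hj))

theorem IsSupersmooth.odd_mul (hU : IsOpen U) (hf : IsSupersmooth f U) (k : Fin n) :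
    IsSupersmooth (fun X => (X.2 k : FG) * f X) U := by
  obtain ⟨u, hu, hf⟩ := hf
  choose c hc using fun a => exists_odd_mul_oddPow k a
  refine IsSupersmooth.congr (IsSupersmooth.sum hU (s := Finset.univ) fun a _ =>
    isSupersmooth_single ((hu a).smul (c a)) (Function.update a k 1)) fun X hX => ?_
  simp only [hf X hX, Finset.mul_sum]
  refine Finset.sum_congr rfl fun a _ => ?_
  rw [grassmannCont_smul (isOpen_image_body hU) (hu a) (c a) (mem_image_of_mem _ hX), ← mul_assoc,
    hc, smul_mul_assoc, mul_smul_comm]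

theorem IsGSDInfty.isSupersmooth (hU : IsOpen U)
    (hfib : ∀ q : Fin m → ℝ, IsPreconnected {X | X ∈ U ∧ body X = q}) (hf : IsGSDInfty f U) :
    IsSupersmooth f U := by
  classical
  -- Induction on the set of odd directions in which `f` may vary: each splitting removes one of
  -- them, and the empty set is the case of a Grassmann continuation.
  have key : ∀ (s : Finset (Fin n)) (f : SuperSpace m n → FG), IsGSDInfty f U →
      (∀ l ∉ s, OddConst f U l) → IsSupersmooth f U := by
    intro s
    induction s using Finset.induction_on with
    | empty =>
      intro f hf h
      obtain ⟨u, hu, hfu⟩ := exists_eq_grassmannCont hU hfib hf fun k => h k (by simp)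
      refine (isSupersmooth_single hu 0).congr fun X hX => ?_
      simp [hfu X hX, oddPow]
    | insert k s hk ih =>
      intro f hf h
      obtain ⟨f0, f1, h0, h1, hsplit, hc⟩ := exists_odd_split hU hf k
      have hc' : ∀ l ∉ s, OddConst f0 U l ∧ OddConst f1 U l := fun l hl => hc l <| by
        rcases eq_or_ne l k with e | e
        · exact Or.inr e
        · exact Or.inl (h l (by simp [e, hl]))
      exact ((ih f0 h0 fun l hl => (hc' l hl).1).add hU
        ((ih f1 h1 fun l hl => (hc' l hl).2).odd_mul hU k)).congr fun X _ => hsplit X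
  exact key Finset.univ f hf fun l hl => absurd (Finset.mem_univ l) hl

end

end

/-! ### Assembly of the equivalences -/

theorem theorem1p1 (m n : ℕ) (U : Set (SuperSpace m n)) (hU : IsOpen U)
    (f : SuperSpace m n → FG) :
    List.TFAE [IsGSDInfty f U,
      IsCGInfty f U ∧ IsGSD 1 f U,
      IsCGInfty f U ∧ HasRevLinearGDiff f U,
      IsCGInfty f U ∧ CauchyRiemann f U] ∧
    (IsSupersmooth f U → IsGSDInfty f U) ∧
    ((∀ q : Fin m → ℝ, IsPreconnected {X | X ∈ U ∧ body X = q}) →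
      List.TFAE [IsGSDInfty f U,
        IsCGInfty f U ∧ IsGSD 1 f U,
        IsCGInfty f U ∧ HasRevLinearGDiff f U,
        IsCGInfty f U ∧ CauchyRiemann f U,
        IsSupersmooth f U]) := by
  have h := tfae_isGSDInfty hU f
  refine ⟨h, fun hs => hs.isGSDInfty hU, fun hfib => ?_⟩
  tfae_have 1 ↔ 2 := h.out 0 1
  tfae_have 1 ↔ 3 := h.out 0 2
  tfae_have 1 ↔ 4 := h.out 0 3
  tfae_have 1 ↔ 5 := ⟨fun hf => hf.isSupersmooth hU hfib, fun hs => hs.isGSDInfty hU⟩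
  tfae_finish
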